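/- A buyer's valuation lies in $[0,1]$; let $\mathcal P$ be the set of probability distributions on $[0,1]$, $\bar P(x)=\mathbb P_P(\tilde v>x)$, and $d(P,P_0)=\int_0^1|\bar P(x)-\bar P_0(x)|\,dx$ the type-1 Wasserstein distance. A (direct) mechanism is a pair $(q,m):[0,1]\to[0,1]\times\mathbb R$ with $q(v)v-m(v)\ge 0$ and $q(v)v-m(v)\ge q(\omega)v-m(\omega)$ for all $v,\omega\in[0,1]$; the surplus of a buyer with valuation $v$ is $q(v)v-m(v)$. The posted-price mechanism with price $p\in[0,1]$ is $q^{p}(v)=\mathbf 1(v\ge p)$, $m^{p}(v)=p\,\mathbf 1(v\ge p)$. Given a reference distribution $P_0\in\mathcal P$ and a target $\tau>0$, a mechanism satisfies the target with fragility $k>0$ if $\tau-\mathbb E_P[m(\tilde v)]\le k\,d(P,P_0)$ for all $P\in\mathcal P$. An optimal RS (robust satisficing) mechanism $(q^*_{RS},m^*_{RS})$ attains the least such $k$ among all mechanisms; an optimal RS posted price $p^{PP}_{RS}$ attains the least such $k$ among all posted-price mechanisms; write $(q^{PP}_{RS},m^{PP}_{RS})$ for the posted-price mechanism with price $p^{PP}_{RS}$.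 $P_0$ is regular if it has a density $f$ that is positive on the interior of its support, a nondegenerate subinterval of $[0,1]$, and $x-\bar P_0(x)/f(x)$ is strictly increasing there. Theorem. (i) Let $P_0$ be regular and $\tau>0$. If $\tau<\max_{x\in[0,1]}x\,\mathbb P_{P_0}(\tilde v\ge x)$, then an optimal RS mechanism and an optimal RS posted price exist. For any optimal RS mechanism and any optimal RS posted price there is a threshold $\underline v_{RS}\in[p^{PP}_{RS},1]$ such that, for every $v\in[0,1]$, $$q^*_{RS}(v)v-m^*_{RS}(v)\ \ge\ q^{PP}_{RS}(v)v-m^{PP}_{RS}(v)\quad\text{if and only if}\quad v\le\underline v_{RS}.$$ (ii) If $P_0(x)=x^\alpha$ on $[0,1]$ for some real $\alpha\ge 1$, and $\tau>0$, then the same existence statement holds, and for any optimal RS mechanism and any optimal RS posted price, $q^*_{RS}(v)v-m^*_{RS}(v)\ge q^{PP}_{RS}(v)v-m^{PP}_{RS}(v)$ for every $v\in[0,1]$. -/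

import Mathlib

open MeasureTheory

namespace RobustPricing

/-- A buyer valuation distribution: a Borel probability measure supported on `[0,1]`. -/
def IsValuationDist (P : Measure ℝ) : Prop :=
  IsProbabilityMeasure P ∧ P (Set.Icc (0 : ℝ) 1)ᶜ = 0

/-- The complementary cumulative distribution function `x ↦ ℙ(ṽ > x)`. -/
noncomputable def ccdf (P : Measure ℝ) (x : ℝ) : ℝ := P.real (Set.Ioi x)

/-- The type-1 Wasserstein distance of two distributions on `[0,1]`. -/
noncomputable def wasserstein (P P₀ : Measure ℝ) : ℝ :=
  ∫ x in (0 : ℝ)..1, |ccdf P x - ccdf P₀ x|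

/-- The expected revenue `x · ℙ(ṽ ≥ x)` of the posted price `x`. -/
noncomputable def revenue (P : Measure ℝ) (x : ℝ) : ℝ := x * P.real (Set.Ici x)

/-- The largest expected revenue of a posted price in `[0,1]`. -/
noncomputable def maxRevenue (P : Measure ℝ) : ℝ := sSup (revenue P '' Set.Icc (0 : ℝ) 1)

/-- Surplus of a truthful buyer with valuation `v` under allocation `q` and payment `m`. -/
def surplus (q m : ℝ → ℝ) (v : ℝ) : ℝ := q v * v - m v

/-- Feasible direct mechanisms: allocation probabilities in `[0,1]`, individual rationality and
incentive compatibility. Only the values of `q` and `m` on `[0,1]` matter. -/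
structure IsMechanism (q m : ℝ → ℝ) : Prop where
  alloc_mem : ∀ v ∈ Set.Icc (0 : ℝ) 1, q v ∈ Set.Icc (0 : ℝ) 1
  individually_rational : ∀ v ∈ Set.Icc (0 : ℝ) 1, 0 ≤ q v * v - m v
  incentive_compatible : ∀ v ∈ Set.Icc (0 : ℝ) 1, ∀ w ∈ Set.Icc (0 : ℝ) 1,
    q w * v - m w ≤ q v * v - m v

/-- The satisficing constraint for the payment rule `m`, the target `τ` and the fragility `k`. -/
def Satisfices (P₀ : Measure ℝ) (τ : ℝ) (m : ℝ → ℝ) (k : ℝ) : Prop :=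
  ∀ P : Measure ℝ, IsValuationDist P → τ - ∫ v, m v ∂P ≤ k * wasserstein P P₀

/-- Feasible points of the robust satisficing problem. -/
def RSFeasible (P₀ : Measure ℝ) (τ : ℝ) (q m : ℝ → ℝ) (k : ℝ) : Prop :=
  IsMechanism q m ∧ 0 < k ∧ Satisfices P₀ τ m k

/-- `(q, m)` is an optimal robust satisficing mechanism: it attains the least fragility among all
feasible direct mechanisms. -/
def IsOptimalRS (P₀ : Measure ℝ) (τ : ℝ) (q m : ℝ → ℝ) : Prop :=
  ∃ k, RSFeasible P₀ τ q m k ∧ ∀ q' m' k', RSFeasible P₀ τ q' m' k' → k ≤ k'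

/-- Allocation rule of the posted price mechanism with price `p`. -/
noncomputable def ppAlloc (p v : ℝ) : ℝ := Set.indicator (Set.Ici p) (fun _ => 1) v

/-- Payment rule of the posted price mechanism with price `p`. -/
noncomputable def ppPay (p v : ℝ) : ℝ := p * Set.indicator (Set.Ici p) (fun _ => 1) v

/-- Feasible points of the robust satisficing problem restricted to posted prices. -/
def PPFeasible (P₀ : Measure ℝ) (τ p k : ℝ) : Prop :=
  p ∈ Set.Icc (0 : ℝ) 1 ∧ 0 < k ∧ Satisfices P₀ τ (ppPay p) k

/-- `p` is an optimal robust satisficing posted price: it attains the least fragility among all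
posted prices. -/
def IsOptimalPP (P₀ : Measure ℝ) (τ p : ℝ) : Prop :=
  ∃ k, PPFeasible P₀ τ p k ∧ ∀ p' k', PPFeasible P₀ τ p' k' → k ≤ k'

/-- Regularity: the distribution has a density that is positive on the interior `(a,b)` of its
support, an interval in `[0,1]`, and the virtual valuation is strictly increasing there. -/
def IsRegular (P : Measure ℝ) : Prop :=
  IsValuationDist P ∧ ∃ (a b : ℝ) (f : ℝ → ℝ), 0 ≤ a ∧ a < b ∧ b ≤ 1 ∧ Measurable f ∧
    (∀ x ∈ Set.Ioo a b, 0 < f x) ∧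
    P = (volume.restrict (Set.Ioo a b)).withDensity (fun x => ENNReal.ofReal (f x)) ∧
    StrictMonoOn (fun x => x - ccdf P x / f x) (Set.Ioo a b)

/-- The power distribution with cumulative distribution function `x ^ α` on `[0,1]`. -/
def IsPowerDist (α : ℝ) (P : Measure ℝ) : Prop :=
  IsValuationDist P ∧ ∀ x ∈ Set.Icc (0 : ℝ) 1, P.real (Set.Iic x) = x ^ α

end RobustPricing

open RobustPricing

/-! The surplus u of a mechanism is nondecreasing with slope at most 1, since the allocation is a
subgradient of it. The surplus of a posted price p is max(v - p, 0), with slope exactly 1 beyond p.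
Hence the difference is nonnegative up to p and nonincreasing afterwards, which gives the threshold
of part (i) (`exists_surplus_threshold`). Existence is compactness: a minimising sequence of prices,
or of monotone rules via Helly, has a limit that inherits every constraint.

For part (ii), the slope bound reduces the claim to the top type: u(1) ≥ 1 - p suffices. Let L be
the largest k-Lipschitz minorant of the payment rule m. Transporting P₀ to near-minimisers shows
that satisficing forces ∫ L dP₀ ≥ τ (`Satisfices.le_integral_envelope`). Conversely, by Kantorovich
duality, a nonnegative k-Lipschitz minorant with mean above τ can be scaled down, and this lowers k.
So at the optimal k no competitor has such a minorant with mean above τ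
(`integral_le_target_of_optimal`), and optimality can be exploited by variations.

Power distributions behave well under rescaling v to v / r. Rescaling the posted price gives (1 + α)
τ ≤ α p, and rescaling the optimal mechanism gives α L(1) ≤ (1 + α) τ. The two optimal fragilities
may differ, but both bounds involve only τ, so L(1) ≤ p.

It remains to see that u(1) + L(1) ≥ 1 (`IsPowerDist.one_le_surplus_add_envelope`). A payment rule l
is implementable once l(1) + ∫ l(s) / s² ds ≤ 1, and ∫ L(s) / s² ds ≤ u(1). If the sum were below 1,
mixing a little of the steepest rule k v into L would remain implementable and raise the mean above
τ. Therefore u(1) ≥ 1 - L(1) ≥ 1 - p. -/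

open Filter Topology

namespace RobustPricing

/-! ### Incentive compatibility: monotonicity and slope of the surplus -/

namespace IsMechanism

variable {q m : ℝ → ℝ}

lemma surplus_nonneg (h : IsMechanism q m) {v : ℝ} (hv : v ∈ Set.Icc (0 : ℝ) 1) :
    0 ≤ surplus q m v := h.individually_rational v hv

/-- Incentive compatibility in subgradient form: the allocation at w supports the surplus at w. -/
lemma surplus_ge (h : IsMechanism q m) {v w : ℝ} (hv : v ∈ Set.Icc (0 : ℝ) 1)
    (hw : w ∈ Set.Icc (0 : ℝ) 1) : surplus q m w + q w * (v - w) ≤ surplus q m v := by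
  have := h.incentive_compatible v hv w hw
  simp only [surplus]
  linarith

lemma monotoneOn_alloc (h : IsMechanism q m) : MonotoneOn q (Set.Icc 0 1) := by
  intro v hv w hw hvw
  rcases hvw.eq_or_lt with rfl | hlt
  · rfl
  have h1 := h.surplus_ge hv hw
  have h2 := h.surplus_ge hw hv
  by_contra! hc
  nlinarith [mul_pos (sub_pos.2 hlt) (sub_pos.2 hc)]

lemma monotoneOn_pay (h : IsMechanism q m) : MonotoneOn m (Set.Icc 0 1) := by
  intro v hv w hw hvw
  have h1 := h.incentive_compatible v hv w hw
  have h2 := h.monotoneOn_alloc hv hw hvw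
  nlinarith [mul_nonneg (sub_nonneg.2 h2) hv.1]

lemma surplus_mono (h : IsMechanism q m) : MonotoneOn (surplus q m) (Set.Icc 0 1) := by
  intro v hv w hw hvw
  have h1 := h.surplus_ge hw hv
  nlinarith [mul_nonneg (h.alloc_mem v hv).1 (sub_nonneg.2 hvw)]

lemma surplus_sub_le (h : IsMechanism q m) {v w : ℝ} (hv : v ∈ Set.Icc (0 : ℝ) 1)
    (hw : w ∈ Set.Icc (0 : ℝ) 1) (hvw : v ≤ w) : surplus q m w - surplus q m v ≤ w - v := by
  have h1 := h.surplus_ge hv hw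
  nlinarith [mul_nonneg (sub_nonneg.2 (h.alloc_mem w hw).2) (sub_nonneg.2 hvw)]

lemma pay_le_one (h : IsMechanism q m) {v : ℝ} (hv : v ∈ Set.Icc (0 : ℝ) 1) : m v ≤ 1 := by
  have h1 := h.individually_rational v hv
  have h2 := h.alloc_mem v hv
  nlinarith [h2.1, h2.2, hv.1, hv.2]

lemma pay_zero_le (h : IsMechanism q m) : m 0 ≤ 0 := by
  have h1 := h.individually_rational 0 (by simp)
  linarith

end IsMechanism

/-! ### Posted prices and the threshold comparison -/

lemma surplus_pp (p v : ℝ) : surplus (ppAlloc p) (ppPay p) v = max (v - p) 0 := by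
  by_cases hv : p ≤ v
  · rw [max_eq_left (by linarith)]
    simp [surplus, ppAlloc, ppPay, hv]
  · push Not at hv
    rw [max_eq_right (by linarith)]
    simp [surplus, ppAlloc, ppPay, hv]

lemma ppPay_of_le {p v : ℝ} (h : p ≤ v) : ppPay p v = p := by simp [ppPay, h]

lemma ppPay_of_lt {p v : ℝ} (h : v < p) : ppPay p v = 0 := by simp [ppPay, h]

lemma isMechanism_pp (p : ℝ) : IsMechanism (ppAlloc p) (ppPay p) where
  alloc_mem v _ := by
    by_cases hv : p ≤ v <;> simp [ppAlloc, hv]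
  individually_rational v _ := by
    have := surplus_pp p v
    simp only [surplus] at this
    rw [this]; exact le_max_right _ _
  incentive_compatible v _ w _ := by
    have := surplus_pp p v
    simp only [surplus] at this
    rw [this]
    by_cases hw : p ≤ w
    · simp [ppAlloc, ppPay, hw]
    · simp [ppAlloc, ppPay, hw]

/-- Against any posted price, the valuations at which a mechanism leaves more surplus form an
initial segment that contains the price. -/
lemma exists_surplus_threshold {q m : ℝ → ℝ} {p : ℝ} (h : IsMechanism q m)
    (hp : p ∈ Set.Icc (0 : ℝ) 1) :
    ∃ t ∈ Set.Icc p 1, ∀ v ∈ Set.Icc (0 : ℝ) 1,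
      (surplus (ppAlloc p) (ppPay p) v ≤ surplus q m v ↔ v ≤ t) := by
  set S := {v | v ∈ Set.Icc p 1 ∧ v - p ≤ surplus q m v} with hS
  have hpS : p ∈ S := ⟨⟨le_rfl, hp.2⟩, by simpa using h.surplus_nonneg hp⟩
  have hbdd : BddAbove S := ⟨1, fun v hv => hv.1.2⟩
  have hle : sSup S ≤ 1 := csSup_le ⟨p, hpS⟩ fun v hv => hv.1.2
  have hge : p ≤ sSup S := le_csSup hbdd hpS
  refine ⟨sSup S, ⟨hge, hle⟩, fun v hv => ?_⟩
  rw [surplus_pp]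
  constructor
  · intro hle'
    rcases le_total v p with hvp | hvp
    · exact hvp.trans hge
    · exact le_csSup hbdd ⟨⟨hvp, hv.2⟩, (le_max_left _ _).trans hle'⟩
  · intro hvt
    refine max_le ?_ (h.surplus_nonneg hv)
    -- Instead of showing that the supremum belongs to `S`, take w in `S` within ε of it. If v ≤ w,
    -- the slope bound carries the inequality down from w to v. If w ≤ v, then v - w < ε and
    -- monotonicity suffices.
    refine le_of_forall_pos_le_add fun ε hε => ?_
    rcases le_total v p with hvp | hvp
    · have := h.surplus_nonneg hv
      linarith
    obtain ⟨w, hw, hwε⟩ := exists_lt_of_lt_csSup ⟨p, hpS⟩ (show sSup S - ε < sSup S by linarith)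
    have hw01 : w ∈ Set.Icc (0 : ℝ) 1 := ⟨hp.1.trans hw.1.1, hw.1.2⟩
    have hw2 := hw.2
    rcases le_total v w with hvw | hvw
    · have := h.surplus_sub_le hv hw01 hvw
      linarith
    · have := h.surplus_mono hw01 hv hvw
      linarith

/-! ### Valuation distributions and Wasserstein distance: basic facts -/

lemma IsValuationDist.ae_mem {P : Measure ℝ} (hP : IsValuationDist P) :
    ∀ᵐ v ∂P, v ∈ Set.Icc (0 : ℝ) 1 := hP.2

lemma IsValuationDist.integrable_of_monotoneOn {P : Measure ℝ} (hP : IsValuationDist P)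
    {f : ℝ → ℝ} (hf : MonotoneOn f (Set.Icc 0 1)) : Integrable f P := by
  have := hP.1
  have h := hf.integrableOn_isCompact (μ := P) isCompact_Icc
  rwa [IntegrableOn, Measure.restrict_eq_self_of_ae_mem hP.ae_mem] at h

lemma antitone_ccdf (P : Measure ℝ) [IsProbabilityMeasure P] : Antitone (ccdf P) :=
  fun _ _ h => measureReal_mono (Set.Ioi_subset_Ioi h)

lemma intervalIntegrable_abs_ccdf_sub {P Q : Measure ℝ} (hP : IsValuationDist P)
    (hQ : IsValuationDist Q) (a b : ℝ) :
    IntervalIntegrable (fun x => |ccdf P x - ccdf Q x|) volume a b := by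
  have := hP.1
  have := hQ.1
  exact ((antitone_ccdf P).intervalIntegrable.sub (antitone_ccdf Q).intervalIntegrable).abs

lemma wasserstein_nonneg (P Q : Measure ℝ) : 0 ≤ wasserstein P Q :=
  intervalIntegral.integral_nonneg (by norm_num) fun _ _ => abs_nonneg _

lemma isValuationDist_dirac {x : ℝ} (hx : x ∈ Set.Icc (0 : ℝ) 1) :
    IsValuationDist (Measure.dirac x) :=
  ⟨inferInstance, by rw [Measure.dirac_apply' _ measurableSet_Icc.compl]; simp [hx.1, hx.2]⟩

lemma integral_ppPay (P : Measure ℝ) (p : ℝ) : ∫ v, ppPay p v ∂P = p * P.real (Set.Ici p) := by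
  simp only [ppPay]
  rw [integral_const_mul, integral_indicator_const _ measurableSet_Ici]
  simp

/-! ### Existence of optimal prices and mechanisms -/

/-- A fragility that satisfies the target with a mechanism charging nothing at valuation `0` is
positive. -/
lemma pos_of_satisfices {P₀ : Measure ℝ} {τ k : ℝ} {m : ℝ → ℝ} (hτ : 0 < τ)
    (hm : m 0 ≤ 0) (h : Satisfices P₀ τ m k) : 0 < k := by
  -- At the point mass at 0 the revenue is at most 0, so the shortfall is at least τ > 0.
  have h1 := h (Measure.dirac 0) (isValuationDist_dirac (by simp))
  rw [integral_dirac] at h1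
  by_contra! hk
  nlinarith [mul_nonneg (neg_nonneg.2 hk) (wasserstein_nonneg (Measure.dirac 0) P₀)]

lemma ppPay_zero_le (p : ℝ) : ppPay p 0 ≤ 0 := by
  rcases le_or_gt p 0 with h | h
  · rwa [ppPay_of_le h]
  · rw [ppPay_of_lt h]

/-- Below the maximal revenue the target can be met by some posted price. -/
lemma exists_ppFeasible {P₀ : Measure ℝ} {τ : ℝ} (hP₀ : IsValuationDist P₀) (hτ : 0 < τ)
    (hmax : τ < maxRevenue P₀) : ∃ p k, PPFeasible P₀ τ p k := by
  have := hP₀.1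
  obtain ⟨_, ⟨x, hx, rfl⟩, hτx⟩ := exists_lt_of_lt_csSup
    ((Set.nonempty_Icc.2 zero_le_one).image (revenue P₀)) hmax
  set s := P₀.real (Set.Ici x) with hs
  have hτx : τ < x * s := hτx
  have hs0 : 0 ≤ s := measureReal_nonneg
  have hxpos : 0 < x := by
    by_contra! hc
    nlinarith
  have hspos : 0 < s := by
    by_contra! hc
    nlinarith
  -- Underprice x: this p, sold with probability s, earns exactly τ, and p < x leaves a margin. If
  -- sales at p drop from s to r, the two tails differ by at least s - r on all of (p, x), so the
  -- distance is at least (x - p)(s - r).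
  set p := τ / s with hp
  have hps : p * s = τ := by rw [hp]; field_simp
  have hp0 : 0 < p := by positivity
  have hpx : p < x := by
    by_contra! hc
    nlinarith
  have hsat : Satisfices P₀ τ (ppPay p) (p / (x - p)) := by
    intro P hP
    have := hP.1
    rw [integral_ppPay]
    set r := P.real (Set.Ici p) with hr
    have key : (x - p) * (s - r) ≤ wasserstein P P₀ := by
      calc (x - p) * (s - r) = ∫ _ in p..x, (s - r) := by simp [mul_sub]
        _ ≤ ∫ y in p..x, |ccdf P y - ccdf P₀ y| := by
            refine intervalIntegral.integral_mono_on_of_le_Ioo hpx.le (by simp)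
              (intervalIntegrable_abs_ccdf_sub hP hP₀ _ _) fun y hy => ?_
            have h1 : ccdf P y ≤ r := measureReal_mono fun z hz => hy.1.le.trans (le_of_lt hz)
            have h2 : s ≤ ccdf P₀ y := measureReal_mono fun z hz => lt_of_lt_of_le hy.2 hz
            rw [abs_sub_comm]
            exact le_trans (by linarith) (le_abs_self _)
        _ ≤ wasserstein P P₀ :=
            intervalIntegral.integral_mono_interval hp0.le hpx.le hx.2
              (ae_of_all _ fun _ => abs_nonneg _) (intervalIntegrable_abs_ccdf_sub hP hP₀ _ _)
    have hxp : 0 < x - p := sub_pos.2 hpx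
    calc τ - p * r = p / (x - p) * ((x - p) * (s - r)) := by
          rw [← hps]; field_simp
      _ ≤ _ := mul_le_mul_of_nonneg_left key (by positivity)
  exact ⟨p, _, ⟨hp0.le, hpx.le.trans hx.2⟩, div_pos hp0 (sub_pos.2 hpx), hsat⟩

/-- A nonempty set of positive reals contains a minimising sequence. -/
lemma exists_seq_tendsto_csInf_of_pos {S : Set ℝ} (hne : S.Nonempty) (hpos : ∀ k ∈ S, 0 < k) :
    ∃ u : ℕ → ℝ, (∀ n, u n ∈ S) ∧ Tendsto u atTop (𝓝 (sInf S)) ∧ ∀ k ∈ S, sInf S ≤ k := by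
  have hbdd : BddBelow S := ⟨0, fun k hk => (hpos k hk).le⟩
  obtain ⟨u, -, hu, huS⟩ := exists_seq_tendsto_sInf hne hbdd
  exact ⟨u, huS, hu, fun k hk => csInf_le hbdd hk⟩

/-- Prices range over a compact set, and for each P the revenue is upper semicontinuous in the price
because ℙ(ṽ ≥ y) is left-continuous. So the constraint survives the limit. -/
lemma exists_isOptimalPP {P₀ : Measure ℝ} {τ : ℝ} (hτ : 0 < τ)
    (hne : ∃ p k, PPFeasible P₀ τ p k) : ∃ p, IsOptimalPP P₀ τ p := by
  obtain ⟨p₁, k₁, h₁⟩ := hne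
  obtain ⟨u, hu, hlim, hle⟩ := exists_seq_tendsto_csInf_of_pos
    (S := {k | ∃ p, PPFeasible P₀ τ p k}) ⟨k₁, p₁, h₁⟩ fun k ⟨p, hp⟩ => hp.2.1
  set K := sInf {k | ∃ p, PPFeasible P₀ τ p k}
  choose x hx using hu
  obtain ⟨p, hp, φ, hφ, hpl⟩ := isCompact_Icc.tendsto_subseq (fun n => (hx n).1)
  have hsat : Satisfices P₀ τ (ppPay p) K := by
    intro P hP
    have := hP.1
    rw [integral_ppPay]
    have hcont : Tendsto (fun y => P.real (Set.Ici y)) (𝓝[<] p) (𝓝 (P.real (Set.Ici p))) := by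
      -- Left-continuity is continuity from above along the sets [y, ∞), which decrease as y
      -- increases to p; the order dual turns the left limit into a right one.
      have h := tendsto_measure_biInter_gt (μ := P) (ι := ℝᵒᵈ) (s := fun y => Set.Ici (OrderDual.ofDual y))
        (a := OrderDual.toDual p) (fun r _ => measurableSet_Ici.nullMeasurableSet)
        (fun i j _ hij => Set.Ici_subset_Ici.2 hij) ⟨OrderDual.toDual (p - 1), sub_one_lt p, measure_ne_top _ _⟩
      have he : (⋂ r : ℝᵒᵈ, ⋂ (_ : r > OrderDual.toDual p), Set.Ici (OrderDual.ofDual r)) =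
          Set.Ici p := by
        ext z
        simp only [Set.mem_iInter, Set.mem_Ici]
        exact ⟨fun h => le_of_forall_lt_imp_le_of_dense fun y hy => h (OrderDual.toDual y) hy,
          fun h r hr => le_trans (le_of_lt hr) h⟩
      rw [he] at h
      exact (ENNReal.tendsto_toReal (measure_ne_top _ _)).comp h
    -- The prices may approach p from either side. Eventually they exceed a fixed y < p, which
    -- bounds their sale probability; y then tends to p.
    have hbound : ∀ y < p, τ - K * wasserstein P P₀ ≤ p * P.real (Set.Ici y) := by
      intro y hy
      have hl : Tendsto (fun n => τ - u (φ n) * wasserstein P P₀) atTop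
          (𝓝 (τ - K * wasserstein P P₀)) :=
        tendsto_const_nhds.sub ((hlim.comp hφ.tendsto_atTop).mul_const _)
      have hr : Tendsto (fun n => x (φ n) * P.real (Set.Ici y)) atTop
          (𝓝 (p * P.real (Set.Ici y))) := hpl.mul_const _
      refine le_of_tendsto_of_tendsto hl hr ?_
      filter_upwards [hpl.eventually (lt_mem_nhds hy)] with n hn
      have h1 := (hx (φ n)).2.2 P hP
      rw [integral_ppPay] at h1
      have h2 : P.real (Set.Ici (x (φ n))) ≤ P.real (Set.Ici y) :=
        measureReal_mono (Set.Ici_subset_Ici.2 (le_of_lt hn))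
      have h3 := mul_le_mul_of_nonneg_left h2 (hx (φ n)).1.1
      linarith
    have := ge_of_tendsto (hcont.const_mul p)
      (eventually_nhdsWithin_of_forall fun y hy => hbound y hy)
    linarith
  exact ⟨p, K, ⟨hp, pos_of_satisfices hτ (ppPay_zero_le p) hsat, hsat⟩,
    fun p' k' h' => hle k' ⟨p', h'⟩⟩

/-- **Helly's selection theorem** for nondecreasing functions on `[0,1]`. -/
lemma exists_subseq_tendsto_of_monotoneOn {f : ℕ → ℝ → ℝ} {a b : ℝ}
    (hf : ∀ n, MonotoneOn (f n) (Set.Icc 0 1))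
    (hb : ∀ n, ∀ v ∈ Set.Icc (0 : ℝ) 1, f n v ∈ Set.Icc a b) :
    ∃ (g : ℝ → ℝ) (φ : ℕ → ℕ), StrictMono φ ∧
      ∀ v ∈ Set.Icc (0 : ℝ) 1, Tendsto (fun n => f (φ n) v) atTop (𝓝 (g v)) := by
  set F : ℕ → ℝ → ℝ := fun n x => f n (Set.projIcc (0 : ℝ) 1 zero_le_one x) with hF
  have hFmono : ∀ n, Monotone (F n) := fun n x y hxy =>
    hf n (Subtype.coe_prop _) (Subtype.coe_prop _) (Set.monotone_projIcc _ hxy)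
  have hFb : ∀ n x, F n x ∈ Set.Icc a b := fun n x => hb n _ (Subtype.coe_prop _)
  have hFeq : ∀ n, ∀ v ∈ Set.Icc (0 : ℝ) 1, F n v = f n v := fun n v hv => by
    simp only [hF, Set.projIcc_of_mem _ hv]
  -- An ultrafilter supplies a candidate limit at all points at once. A genuine subsequence is then
  -- extracted on a countable set, where the product space is first countable.
  have hlim : ∀ x, ∃ y, Tendsto (fun n => F n x) (hyperfilter ℕ : Filter ℕ) (𝓝 y) := by
    intro x
    obtain ⟨y, -, hy⟩ := (isCompact_Icc (a := a) (b := b)).ultrafilter_le_nhds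
      ((hyperfilter ℕ).map fun n => F n x)
      (by rw [Ultrafilter.coe_map, le_principal_iff]; exact mem_map.2 (univ_mem' fun n => hFb n x))
    exact ⟨y, hy⟩
  choose g hg using hlim
  have hgmono : Monotone g := fun x y hxy =>
    le_of_tendsto_of_tendsto' (hg x) (hg y) fun n => hFmono n hxy
  -- At continuity points of g outside `D`, monotonicity squeezes the values between those at nearby
  -- rationals.
  set D : Set ℝ := Set.range ((↑) : ℚ → ℝ) ∪ {x | ¬ ContinuousAt g x} with hD
  have hDc : D.Countable := (Set.countable_range _).union hgmono.countable_not_continuousAt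
  have := hDc.to_subtype
  have hcl : MapClusterPt (fun x : D => g x) atTop (fun n => fun x : D => F n x) := by
    have h1 : Tendsto (fun n => fun x : D => F n x) (hyperfilter ℕ : Filter ℕ)
        (𝓝 fun x : D => g x) := tendsto_pi_nhds.2 fun x => hg x
    exact h1.mapClusterPt.mono (Nat.hyperfilter_le_atTop)
  obtain ⟨φ, hφ, hφl⟩ := hcl.tendsto_subseq
  rw [tendsto_pi_nhds] at hφl
  have hall : ∀ v, Tendsto (fun n => F (φ n) v) atTop (𝓝 (g v)) := by
    intro v
    by_cases hv : v ∈ D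
    · exact hφl ⟨v, hv⟩
    have hcont : ContinuousAt g v := by
      by_contra hc
      exact hv (Or.inr hc)
    have hrat : ∀ r : ℚ, Tendsto (fun n => F (φ n) r) atTop (𝓝 (g r)) := fun r =>
      hφl ⟨r, Or.inl ⟨r, rfl⟩⟩
    rw [tendsto_order]
    constructor
    · intro c hc
      obtain ⟨y, hy, hyc⟩ : ∃ y < v, ∀ z ∈ Set.Ioc y v, c < g z :=
        exists_Ioc_subset_of_mem_nhds (hcont.eventually (lt_mem_nhds hc)) ⟨v - 1, by simp⟩
      obtain ⟨r, hr1, hr2⟩ := exists_rat_btwn hy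
      filter_upwards [(hrat r).eventually (lt_mem_nhds (hyc r ⟨hr1, hr2.le⟩))] with n hn
      exact lt_of_lt_of_le hn (hFmono _ hr2.le)
    · intro c hc
      obtain ⟨y, hy, hyc⟩ : ∃ y > v, ∀ z ∈ Set.Ico v y, g z < c :=
        exists_Ico_subset_of_mem_nhds (hcont.eventually (gt_mem_nhds hc)) ⟨v + 1, by simp⟩
      obtain ⟨r, hr1, hr2⟩ := exists_rat_btwn hy
      filter_upwards [(hrat r).eventually (gt_mem_nhds (hyc r ⟨hr1.le, hr2⟩))] with n hn
      exact lt_of_le_of_lt (hFmono _ hr1.le) hn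
  exact ⟨g, φ, hφ, fun v hv => by simpa only [hFeq _ v hv] using hall v⟩

/-- Payments of a mechanism that satisfies a positive target are bounded below by `-1`. -/
lemma neg_one_le_pay {P₀ : Measure ℝ} {τ k : ℝ} {q m : ℝ → ℝ} (hP₀ : IsValuationDist P₀)
    (hτ : 0 < τ) (h : RSFeasible P₀ τ q m k) {v : ℝ} (hv : v ∈ Set.Icc (0 : ℝ) 1) : -1 ≤ m v := by
  have := hP₀.1
  have h0 : (0 : ℝ) ∈ Set.Icc (0 : ℝ) 1 := by simp
  have h1 : (1 : ℝ) ∈ Set.Icc (0 : ℝ) 1 := by simp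
  have hle : ∫ v, m v ∂P₀ ≤ m 1 := by
    have := integral_mono_ae (hP₀.integrable_of_monotoneOn h.1.monotoneOn_pay)
      (integrable_const (m 1)) (hP₀.ae_mem.mono fun v hv => h.1.monotoneOn_pay hv h1 hv.2)
    simpa using this
  -- Testing with P₀ itself gives τ ≤ m 1. Since the surplus at 0 is at most that at 1, -m 0 ≤ 1 -
  -- τ.
  have hs := h.2.2 P₀ hP₀
  simp only [wasserstein, sub_self, abs_zero, intervalIntegral.integral_zero, mul_zero] at hs
  have h2 := h.1.surplus_mono h0 h1 zero_le_one
  have h3 := (h.1.alloc_mem 1 h1).2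
  have h4 := h.1.monotoneOn_pay h0 hv hv.1
  simp only [surplus] at h2
  linarith

/-- Both rules are monotone and uniformly bounded, so Helly applies to each in turn. Being a
mechanism is closed under pointwise limits, and dominated convergence passes the limit through each
revenue constraint. -/
lemma exists_isOptimalRS {P₀ : Measure ℝ} {τ : ℝ} (hP₀ : IsValuationDist P₀) (hτ : 0 < τ)
    (hne : ∃ q m k, RSFeasible P₀ τ q m k) : ∃ q m, IsOptimalRS P₀ τ q m := by
  obtain ⟨q₁, m₁, k₁, h₁⟩ := hne
  obtain ⟨u, hu, hlim, hle⟩ := exists_seq_tendsto_csInf_of_pos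
    (S := {k | ∃ q m, RSFeasible P₀ τ q m k}) ⟨k₁, q₁, m₁, h₁⟩ fun k ⟨q, m, h⟩ => h.2.1
  set K := sInf {k | ∃ q m, RSFeasible P₀ τ q m k}
  choose Q M hQM using hu
  obtain ⟨q, φ, hφ, hq⟩ := exists_subseq_tendsto_of_monotoneOn
    (fun n => (hQM n).1.monotoneOn_alloc) fun n v hv => (hQM n).1.alloc_mem v hv
  obtain ⟨m, ψ, hψ, hm⟩ := exists_subseq_tendsto_of_monotoneOn (f := fun n => M (φ n))
    (fun n => (hQM (φ n)).1.monotoneOn_pay) fun n v hv =>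
      (⟨neg_one_le_pay hP₀ hτ (hQM (φ n)) hv, (hQM (φ n)).1.pay_le_one hv⟩ :
        M (φ n) v ∈ Set.Icc (-1) 1)
  have hq' : ∀ v ∈ Set.Icc (0 : ℝ) 1, Tendsto (fun n => Q (φ (ψ n)) v) atTop (𝓝 (q v)) :=
    fun v hv => (hq v hv).comp hψ.tendsto_atTop
  have hmech : IsMechanism q m :=
    { alloc_mem := fun v hv => isClosed_Icc.mem_of_tendsto (hq' v hv)
        (Eventually.of_forall fun n => (hQM _).1.alloc_mem v hv)
      individually_rational := fun v hv => ge_of_tendsto' (((hq' v hv).mul_const v).sub (hm v hv))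
        fun n => (hQM _).1.individually_rational v hv
      incentive_compatible := fun v hv w hw => le_of_tendsto_of_tendsto'
        (((hq' w hw).mul_const v).sub (hm w hw)) (((hq' v hv).mul_const v).sub (hm v hv))
        fun n => (hQM _).1.incentive_compatible v hv w hw }
  have hsat : Satisfices P₀ τ m K := by
    intro P hP
    have := hP.1
    have hint : Tendsto (fun n => ∫ v, M (φ (ψ n)) v ∂P) atTop (𝓝 (∫ v, m v ∂P)) := by
      refine tendsto_integral_of_dominated_convergence (fun _ => 1)
        (fun n => (hP.integrable_of_monotoneOn (hQM _).1.monotoneOn_pay).aestronglyMeasurable)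
        (integrable_const _) (fun n => hP.ae_mem.mono fun v hv => ?_)
        (hP.ae_mem.mono fun v hv => hm v hv)
      rw [Real.norm_eq_abs, abs_le]
      exact ⟨neg_one_le_pay hP₀ hτ (hQM _) hv, (hQM _).1.pay_le_one hv⟩
    exact le_of_tendsto_of_tendsto' (tendsto_const_nhds.sub hint)
      ((hlim.comp (hφ.comp hψ).tendsto_atTop).mul_const _) fun n => (hQM _).2.2 P hP
  exact ⟨q, m, K, ⟨hmech, pos_of_satisfices hτ hmech.pay_zero_le hsat, hsat⟩,
    fun q' m' k' h' => hle k' ⟨q', m', h'⟩⟩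

lemma exists_isOptimal {P₀ : Measure ℝ} {τ : ℝ} (hP₀ : IsValuationDist P₀) (hτ : 0 < τ)
    (hmax : τ < maxRevenue P₀) :
    (∃ q m : ℝ → ℝ, IsOptimalRS P₀ τ q m) ∧ ∃ p : ℝ, IsOptimalPP P₀ τ p := by
  obtain ⟨p, k, h⟩ := exists_ppFeasible hP₀ hτ hmax
  exact ⟨exists_isOptimalRS hP₀ hτ ⟨_, _, k, isMechanism_pp p, h.2.1, h.2.2⟩,
    exists_isOptimalPP hτ ⟨p, k, h⟩⟩

/-! ### Lipschitz test functions and transport -/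

lemma continuous_of_le_add_mul {f : ℝ → ℝ} {k : ℝ} (hk : 0 ≤ k)
    (hf : ∀ x y, f x ≤ f y + k * |x - y|) : Continuous f := by
  lift k to NNReal using hk
  exact (LipschitzWith.of_le_add_mul k fun x y => by rw [Real.dist_eq]; exact hf x y).continuous

lemma IsValuationDist.integrable_of_continuous {P : Measure ℝ} (hP : IsValuationDist P)
    {f : ℝ → ℝ} (hf : Continuous f) : Integrable f P := by
  have := hP.1
  have h := hf.continuousOn.integrableOn_compact (μ := P) (isCompact_Icc (a := (0 : ℝ)) (b := 1))
  rwa [IntegrableOn, Measure.restrict_eq_self_of_ae_mem hP.ae_mem] at h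

lemma measurableSet_snd_lt_fst : MeasurableSet {z : ℝ × ℝ | z.2 < z.1} :=
  measurableSet_lt measurable_snd measurable_fst

/-- The layer-cake formula for Lipschitz functions. -/
lemma integral_eq_integral_deriv_mul_ccdf {P : Measure ℝ} (hP : IsValuationDist P) {f : ℝ → ℝ}
    {k : ℝ} (hk : 0 ≤ k) (hf : ∀ x y, f x ≤ f y + k * |x - y|) :
    ∫ v, f v ∂P = f 0 + ∫ x in (0 : ℝ)..1, deriv f x * ccdf P x := by
  have := hP.1
  have hcont := continuous_of_le_add_mul hk hf
  lift k to NNReal using hk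
  have hlip : LipschitzWith k f :=
    LipschitzWith.of_le_add_mul k fun x y => by rw [Real.dist_eq]; exact hf x y
  -- Write f(v) - f(0) as the integral of f' over x < v, then exchange the integrals by Fubini.
  set F : ℝ → ℝ → ℝ := fun v x => {z : ℝ × ℝ | z.2 < z.1}.indicator (fun z => deriv f z.2) (v, x)
    with hF
  have hint : Integrable (Function.uncurry F) (P.prod (volume.restrict (Set.Ioc (0 : ℝ) 1))) := by
    refine Integrable.of_bound (C := k) ?_ (ae_of_all _ fun z => ?_)
    · exact (((measurable_deriv f).comp measurable_snd).indicator
        measurableSet_snd_lt_fst).aestronglyMeasurable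
    · exact (norm_indicator_le_norm_self (fun z : ℝ × ℝ => deriv f z.2) z).trans (norm_deriv_le_of_lipschitz hlip)
  have h1 : ∀ v ∈ Set.Icc (0 : ℝ) 1, f v = f 0 + ∫ x in Set.Ioc (0 : ℝ) 1, F v x := by
    intro v hv
    have hac := (hlip.lipschitzOnWith (s := Set.uIcc 0 v)).absolutelyContinuousOnInterval
    have h2 := hac.integral_deriv_eq_sub
    have h3 : ∫ x in Set.Ioc (0 : ℝ) 1, F v x = ∫ x in (0 : ℝ)..v, deriv f x := by
      have h4 : ∀ x, F v x = (Set.Iio v).indicator (deriv f) x := fun x => by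
        by_cases hx : x < v <;> simp [hF, hx]
      simp only [h4]
      rw [setIntegral_indicator measurableSet_Iio, intervalIntegral.integral_of_le hv.1]
      refine setIntegral_congr_set ?_
      have h5 : Set.Ioc (0 : ℝ) 1 ∩ Set.Iio v = Set.Ioo 0 v := by
        ext x
        simp only [Set.mem_inter_iff, Set.mem_Ioc, Set.mem_Iio, Set.mem_Ioo]
        exact ⟨fun h => ⟨h.1.1, h.2⟩, fun h => ⟨⟨h.1, h.2.le.trans hv.2⟩, h.2⟩⟩
      rw [h5]
      exact Ioo_ae_eq_Ioc
    rw [h3, h2]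
    ring
  calc ∫ v, f v ∂P = ∫ v, (f 0 + ∫ x in Set.Ioc (0 : ℝ) 1, F v x) ∂P :=
        integral_congr_ae (hP.ae_mem.mono h1)
    _ = f 0 + ∫ v, (∫ x in Set.Ioc (0 : ℝ) 1, F v x) ∂P := by
        have := integral_add (integrable_const (f 0)) hint.integral_prod_left
        simp only [Function.uncurry] at this
        rw [this]
        simp
    _ = f 0 + ∫ x in Set.Ioc (0 : ℝ) 1, ∫ v, F v x ∂P := by
        rw [integral_integral_swap hint]
    _ = _ := by
        rw [intervalIntegral.integral_of_le zero_le_one]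
        congr 1
        refine integral_congr_ae (ae_of_all _ fun x => ?_)
        have h4 : ∀ v, F v x = (Set.Ioi x).indicator (fun _ => deriv f x) v := fun v => by
          by_cases hx : x < v <;> simp [hF, hx]
        simp only [h4, integral_indicator_const _ measurableSet_Ioi, ccdf, smul_eq_mul]
        ring

/-- The easy half of Kantorovich duality. -/
lemma integral_le_add_mul_wasserstein {P Q : Measure ℝ} (hP : IsValuationDist P)
    (hQ : IsValuationDist Q) {f : ℝ → ℝ} {k : ℝ} (hk : 0 ≤ k)
    (hf : ∀ x y, f x ≤ f y + k * |x - y|) :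
    ∫ v, f v ∂Q ≤ ∫ v, f v ∂P + k * wasserstein P Q := by
  have := hP.1
  have := hQ.1
  have hderiv : ∀ x, |deriv f x| ≤ k := by
    lift k to NNReal using hk
    exact fun x => norm_deriv_le_of_lipschitz
      (LipschitzWith.of_le_add_mul k fun x y => by rw [Real.dist_eq]; exact hf x y)
  have hi : ∀ R : Measure ℝ, IsProbabilityMeasure R →
      IntervalIntegrable (fun x => deriv f x * ccdf R x) volume 0 1 := by
    intro R hR
    rw [intervalIntegrable_iff]
    exact Integrable.bdd_mul (c := k) (antitone_ccdf R).intervalIntegrable.def'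
      (measurable_deriv f).aestronglyMeasurable (ae_of_all _ fun x => hderiv x)
  rw [integral_eq_integral_deriv_mul_ccdf hP hk hf, integral_eq_integral_deriv_mul_ccdf hQ hk hf,
    add_assoc]
  gcongr
  rw [← sub_le_iff_le_add', ← intervalIntegral.integral_sub (hi Q ‹_›) (hi P ‹_›), wasserstein,
    ← intervalIntegral.integral_const_mul]
  refine intervalIntegral.integral_mono_on zero_le_one ((hi Q ‹_›).sub (hi P ‹_›))
    ((intervalIntegrable_abs_ccdf_sub hP hQ _ _).const_mul _) fun x _ => ?_
  rw [← mul_sub]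
  refine (le_abs_self _).trans ?_
  rw [abs_mul, abs_sub_comm (ccdf P x)]
  gcongr
  exact hderiv x

lemma integral_abs_indicator_sub_le (a b : ℝ) :
    ∫ x in Set.Ioc (0 : ℝ) 1, |(Set.Iio a).indicator (fun _ => (1 : ℝ)) x -
      (Set.Iio b).indicator (fun _ => (1 : ℝ)) x| ≤ |a - b| := by
  have h : ∀ x, |(Set.Iio a).indicator (fun _ => (1 : ℝ)) x -
      (Set.Iio b).indicator (fun _ => (1 : ℝ)) x| =
      (Set.Ico (min a b) (max a b)).indicator (fun _ => (1 : ℝ)) x := by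
    intro x
    simp only [Set.indicator, Set.mem_Iio, Set.mem_Ico, min_le_iff, lt_max_iff]
    split_ifs <;> first | (exfalso; grind) | norm_num
  simp only [h]
  rw [setIntegral_indicator measurableSet_Ico, setIntegral_const, smul_eq_mul, mul_one,
    abs_sub_comm, ← max_sub_min_eq_abs]
  calc _ ≤ volume.real (Set.Ico (min a b) (max a b)) :=
        measureReal_mono Set.inter_subset_right (by simp)
    _ = _ := by rw [Real.volume_real_Ico_of_le min_le_max]

lemma IsValuationDist.map {P : Measure ℝ} (hP : IsValuationDist P) {T : ℝ → ℝ}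
    (hT : Measurable T) (hmem : ∀ v, T v ∈ Set.Icc (0 : ℝ) 1) : IsValuationDist (P.map T) := by
  have := hP.1
  refine ⟨Measure.isProbabilityMeasure_map hT.aemeasurable, ?_⟩
  rw [Measure.map_apply hT measurableSet_Icc.compl]
  have : T ⁻¹' (Set.Icc (0 : ℝ) 1)ᶜ = ∅ := by
    ext v
    simpa using hmem v
  simp [this]

/-- The map T is a coupling, and its cost bounds the distance: |T v - v| dominates the integral over
x in (0, 1] of the difference between the indicators of x < T v and x < v. Fubini turns these into
the tails. -/
lemma wasserstein_map_le {P : Measure ℝ} (hP : IsValuationDist P) {T : ℝ → ℝ}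
    (hT : Measurable T) (hmem : ∀ v, T v ∈ Set.Icc (0 : ℝ) 1) :
    wasserstein (P.map T) P ≤ ∫ v, |T v - v| ∂P := by
  have := hP.1
  have hPT := hP.map hT hmem
  have := hPT.1
  set F : ℝ → ℝ → ℝ := fun v x => |(Set.Iio (T v)).indicator (fun _ => (1 : ℝ)) x -
      (Set.Iio v).indicator (fun _ => (1 : ℝ)) x| with hF
  have hm1 : Measurable fun z : ℝ × ℝ => (Set.Iio (T z.1)).indicator (fun _ => (1 : ℝ)) z.2 :=
    (measurable_const (a := (1 : ℝ))).indicator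
      (measurableSet_lt measurable_snd (hT.comp measurable_fst))
  have hm2 : Measurable fun z : ℝ × ℝ => (Set.Iio z.1).indicator (fun _ => (1 : ℝ)) z.2 :=
    (measurable_const (a := (1 : ℝ))).indicator measurableSet_snd_lt_fst
  have hb : ∀ c x : ℝ, (Set.Iio c).indicator (fun _ => (1 : ℝ)) x ∈ Set.Icc (0 : ℝ) 1 := by
    intro c x
    by_cases hx : x < c <;> simp [hx]
  have hint : Integrable (Function.uncurry F) (P.prod (volume.restrict (Set.Ioc (0 : ℝ) 1))) := by
    refine Integrable.of_bound (C := 1) ?_ (ae_of_all _ fun z => ?_)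
    · exact (continuous_abs.measurable.comp (hm1.sub hm2)).aestronglyMeasurable
    · have h1 := hb (T z.1) z.2
      have h2 := hb z.1 z.2
      rw [Real.norm_eq_abs]
      simp only [hF, Function.uncurry, abs_abs]
      rw [abs_le]
      constructor <;> linarith [h1.1, h1.2, h2.1, h2.2]
  have hdiff : ∀ x, |ccdf (P.map T) x - ccdf P x| ≤ ∫ v, F v x ∂P := by
    intro x
    have h1 : ccdf (P.map T) x = ∫ v, (Set.Iio (T v)).indicator (fun _ => (1 : ℝ)) x ∂P := by
      have : (fun v => (Set.Iio (T v)).indicator (fun _ => (1 : ℝ)) x) =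
          (T ⁻¹' Set.Ioi x).indicator (fun _ => (1 : ℝ)) := by
        ext v
        simp [Set.indicator]
      rw [this, integral_indicator_const _ (hT measurableSet_Ioi), ccdf,
        map_measureReal_apply hT measurableSet_Ioi]
      simp
    have h2 : ccdf P x = ∫ v, (Set.Iio v).indicator (fun _ => (1 : ℝ)) x ∂P := by
      have : (fun v => (Set.Iio v).indicator (fun _ => (1 : ℝ)) x) =
          (Set.Ioi x).indicator (fun _ => (1 : ℝ)) := by
        ext v
        simp [Set.indicator]
      rw [this, integral_indicator_const _ measurableSet_Ioi, ccdf]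
      simp
    have i1 : Integrable (fun v => (Set.Iio (T v)).indicator (fun _ => (1 : ℝ)) x) P :=
      Integrable.of_bound (C := 1)
        (hm1.comp (measurable_id.prodMk measurable_const)).aestronglyMeasurable
        (ae_of_all _ fun v => by rw [Real.norm_eq_abs, abs_of_nonneg (hb _ _).1]; exact (hb _ _).2)
    have i2 : Integrable (fun v => (Set.Iio v).indicator (fun _ => (1 : ℝ)) x) P :=
      Integrable.of_bound (C := 1)
        (hm2.comp (measurable_id.prodMk measurable_const)).aestronglyMeasurable
        (ae_of_all _ fun v => by rw [Real.norm_eq_abs, abs_of_nonneg (hb _ _).1]; exact (hb _ _).2)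
    rw [h1, h2, ← integral_sub i1 i2]
    exact abs_integral_le_integral_abs
  calc wasserstein (P.map T) P = ∫ x in Set.Ioc (0 : ℝ) 1, |ccdf (P.map T) x - ccdf P x| := by
        rw [wasserstein, intervalIntegral.integral_of_le zero_le_one]
    _ ≤ ∫ x in Set.Ioc (0 : ℝ) 1, ∫ v, F v x ∂P := by
        refine integral_mono ?_ hint.integral_prod_right hdiff
        exact (intervalIntegrable_abs_ccdf_sub hPT hP 0 1).1
    _ = ∫ v, (∫ x in Set.Ioc (0 : ℝ) 1, F v x) ∂P := (integral_integral_swap hint).symm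
    _ ≤ ∫ v, |T v - v| ∂P := by
        refine integral_mono_ae hint.integral_prod_left ?_
          (ae_of_all _ fun v => integral_abs_indicator_sub_le _ _)
        refine Integrable.of_bound (C := 1)
          (continuous_abs.measurable.comp (hT.sub measurable_id)).aestronglyMeasurable
          (hP.ae_mem.mono fun v hv => ?_)
        rw [Real.norm_eq_abs, abs_abs, abs_le]
        constructor <;> linarith [hv.1, hv.2, (hmem v).1, (hmem v).2]

/-! ### The Lipschitz envelope and the satisficing constraint -/

/-- The largest `k`-Lipschitz minorant of `m` on `[0,1]`. -/
noncomputable def envelope (m : ℝ → ℝ) (k v : ℝ) : ℝ :=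
  ⨅ w : Set.Icc (0 : ℝ) 1, (m w + k * |v - w|)

section Envelope

variable {m : ℝ → ℝ} {k : ℝ}

lemma le_envelope {c v : ℝ} (h : ∀ w ∈ Set.Icc (0 : ℝ) 1, c ≤ m w + k * |v - w|) :
    c ≤ envelope m k v :=
  have : Nonempty (Set.Icc (0 : ℝ) 1) := ⟨⟨0, by simp⟩⟩
  le_ciInf fun w => h w w.2

lemma envelope_le (hm : MonotoneOn m (Set.Icc 0 1)) (hk : 0 ≤ k) (v : ℝ) {w : ℝ}
    (hw : w ∈ Set.Icc (0 : ℝ) 1) : envelope m k v ≤ m w + k * |v - w| := by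
  refine ciInf_le (f := fun w : Set.Icc (0 : ℝ) 1 => m w + k * |v - w|) ⟨m 0, ?_⟩ ⟨w, hw⟩
  rintro _ ⟨y, rfl⟩
  have := hm (by simp) y.2 y.2.1
  have : 0 ≤ k * |v - y| := by positivity
  linarith

lemma envelope_le_self (hm : MonotoneOn m (Set.Icc 0 1)) (hk : 0 ≤ k) {v : ℝ}
    (hv : v ∈ Set.Icc (0 : ℝ) 1) : envelope m k v ≤ m v := by
  simpa using envelope_le hm hk v hv

lemma zero_le_envelope (hm : MonotoneOn m (Set.Icc 0 1)) (hk : 0 ≤ k) (v : ℝ) :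
    m 0 ≤ envelope m k v := by
  refine le_envelope fun w hw => ?_
  have := hm (by simp) hw hw.1
  have : 0 ≤ k * |v - w| := by positivity
  linarith

lemma envelope_le_add (hm : MonotoneOn m (Set.Icc 0 1)) (hk : 0 ≤ k) (x y : ℝ) :
    envelope m k x ≤ envelope m k y + k * |x - y| := by
  rw [← sub_le_iff_le_add]
  refine le_envelope fun w hw => ?_
  have h1 := envelope_le hm hk x hw
  have h2 := mul_le_mul_of_nonneg_left (abs_sub_le x y w) hk
  linarith

lemma continuous_envelope (hm : MonotoneOn m (Set.Icc 0 1)) (hk : 0 ≤ k) :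
    Continuous (envelope m k) :=
  continuous_of_le_add_mul hk (envelope_le_add hm hk)

lemma monotoneOn_envelope (hm : MonotoneOn m (Set.Icc 0 1)) (hk : 0 ≤ k) :
    MonotoneOn (envelope m k) (Set.Icc 0 1) := by
  intro x hx y hy hxy
  refine le_envelope fun w hw => ?_
  rcases le_total w x with hwx | hwx
  · refine (envelope_le hm hk x hw).trans ?_
    gcongr
  · have h1 := envelope_le_self hm hk hx
    have h2 := hm hx hw hwx
    have : 0 ≤ k * |y - w| := by positivity
    linarith

lemma exists_lt_envelope_add (v : ℝ) {ε : ℝ} (hε : 0 < ε) :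
    ∃ w ∈ Set.Icc (0 : ℝ) 1, m w + k * |v - w| < envelope m k v + ε := by
  have : Nonempty (Set.Icc (0 : ℝ) 1) := ⟨⟨0, by simp⟩⟩
  obtain ⟨w, hw⟩ := exists_lt_of_ciInf_lt
    (show (⨅ w : Set.Icc (0 : ℝ) 1, (m w + k * |v - w|)) < envelope m k v + ε by
      simp only [envelope]; linarith)
  exact ⟨w, w.2, hw⟩

/-- The satisficing constraint bounds the reference expectation of the Lipschitz envelope. -/
lemma Satisfices.le_integral_envelope {P₀ : Measure ℝ} {τ : ℝ} (hP₀ : IsValuationDist P₀)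
    (hm : MonotoneOn m (Set.Icc 0 1)) (hk : 0 ≤ k) (h : Satisfices P₀ τ m k) :
    τ ≤ ∫ v, envelope m k v ∂P₀ := by
  have := hP₀.1
  have hbound : ∀ N : ℕ, τ ≤ (∫ v, envelope m k v ∂P₀) + (1 + 2 * k) * (1 / ((N : ℝ) + 1)) := by
    intro N
    set ε : ℝ := 1 / ((N : ℝ) + 1) with hε
    have hN : (0 : ℝ) < (N : ℝ) + 1 := by positivity
    have hεpos : 0 < ε := by positivity
    choose w hw hwε using fun j : ℕ => exists_lt_envelope_add (m := m) (k := k)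
      ((j : ℝ) * ε) hεpos
    -- Near-minimisers are chosen only at the grid points j ε, which makes T measurable. The error
    -- (1 + 2k) ε consists of ε for near-minimality and k ε twice for replacing v by its grid point,
    -- in the envelope and in the distance.
    set T : ℝ → ℝ := fun v => w ⌊v * ((N : ℝ) + 1)⌋₊ with hT
    have hTm : Measurable T :=
      (measurable_from_top (f := w)).comp (Nat.measurable_floor.comp (measurable_id.mul_const _))
    have hTmem : ∀ v, T v ∈ Set.Icc (0 : ℝ) 1 := fun v => hw _
    have hpt : ∀ v ∈ Set.Icc (0 : ℝ) 1,
        m (T v) + k * |T v - v| ≤ envelope m k v + (1 + 2 * k) * ε := by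
      intro v hv
      set j := ⌊v * ((N : ℝ) + 1)⌋₊ with hj
      have h1 := hwε j
      have hc : |v - (j : ℝ) * ε| ≤ ε := by
        have hf1 := Nat.floor_le (mul_nonneg hv.1 hN.le)
        have hf2 := (Nat.lt_floor_add_one (v * ((N : ℝ) + 1))).le
        rw [← hj] at hf1 hf2
        have hv' : v = v * ((N : ℝ) + 1) * ε := by rw [hε]; field_simp
        rw [abs_le]
        constructor <;> nlinarith
      have h2 := envelope_le_add hm hk ((j : ℝ) * ε) v
      have h3 := mul_le_mul_of_nonneg_left (abs_sub_le (T v) ((j : ℝ) * ε) v) hk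
      rw [abs_sub_comm ((j : ℝ) * ε) v] at h2 h3
      rw [abs_sub_comm (T v) ((j : ℝ) * ε)] at h3
      have h4 := mul_le_mul_of_nonneg_left hc hk
      have h5 : T v = w j := rfl
      rw [h5] at h3 ⊢
      linarith
    have hPT := hP₀.map hTm hTmem
    have hmint := hPT.integrable_of_monotoneOn hm
    have h1 := h _ hPT
    rw [integral_map hTm.aemeasurable hmint.aestronglyMeasurable] at h1
    have h2 := mul_le_mul_of_nonneg_left (wasserstein_map_le hP₀ hTm hTmem) hk
    have i1 : Integrable (fun v => m (T v)) P₀ :=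
      (integrable_map_measure hmint.aestronglyMeasurable hTm.aemeasurable).1 hmint
    have i2 : Integrable (fun v => |T v - v|) P₀ := by
      refine Integrable.of_bound (C := 1)
          (continuous_abs.measurable.comp (hTm.sub measurable_id)).aestronglyMeasurable
          (hP₀.ae_mem.mono fun v hv => ?_)
      rw [Real.norm_eq_abs, abs_abs, abs_le]
      constructor <;> linarith [hv.1, hv.2, (hTmem v).1, (hTmem v).2]
    have i3 := hP₀.integrable_of_continuous (continuous_envelope hm hk)
    have h3 := integral_mono_ae (i1.add (i2.const_mul k))
      (i3.add (integrable_const ((1 + 2 * k) * ε))) (hP₀.ae_mem.mono hpt)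
    simp only [Pi.add_apply] at h3
    rw [integral_add i1 (i2.const_mul k), integral_add i3 (integrable_const _),
      integral_const_mul, integral_const] at h3
    simp only [probReal_univ, smul_eq_mul, one_mul] at h3
    linarith
  have hlim : Tendsto (fun N : ℕ => (∫ v, envelope m k v ∂P₀) +
      (1 + 2 * k) * (1 / ((N : ℝ) + 1))) atTop (𝓝 ((∫ v, envelope m k v ∂P₀) + (1 + 2 * k) * 0)) :=
    tendsto_const_nhds.add (tendsto_one_div_add_atTop_nhds_zero_nat.const_mul _)
  simpa using ge_of_tendsto' hlim hbound

end Envelope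

/-- A Lipschitz minorant of the payments that beats the target allows for a smaller fragility. -/
lemma exists_lt_satisfices {P₀ : Measure ℝ} {τ k : ℝ} {m l : ℝ → ℝ} (hP₀ : IsValuationDist P₀)
    (hτ : 0 < τ) (hk : 0 < k) (hm : MonotoneOn m (Set.Icc 0 1))
    (hl : ∀ x y, l x ≤ l y + k * |x - y|) (hl0 : ∀ v ∈ Set.Icc (0 : ℝ) 1, 0 ≤ l v)
    (hlm : ∀ v ∈ Set.Icc (0 : ℝ) 1, l v ≤ m v) (hlt : τ < ∫ v, l v ∂P₀) :
    ∃ k' < k, 0 < k' ∧ Satisfices P₀ τ m k' := by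
  -- The function c l has mean exactly τ and is c k-Lipschitz, and it stays below m because l ≥ 0
  -- and c < 1.
  set c := τ / ∫ v, l v ∂P₀ with hc
  have hI : 0 < ∫ v, l v ∂P₀ := hτ.trans hlt
  have hc0 : 0 < c := div_pos hτ hI
  have hc1 : c < 1 := (div_lt_one hI).2 hlt
  refine ⟨c * k, by nlinarith, by positivity, fun P hP => ?_⟩
  have h1 := integral_le_add_mul_wasserstein (f := fun v => c * l v) hP hP₀
    (k := c * k) (by positivity) (fun x y => by nlinarith [hl x y])
  have h2 : ∫ v, c * l v ∂P₀ = τ := by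
    rw [integral_const_mul, hc]
    field_simp
  have h3 : ∫ v, c * l v ∂P ≤ ∫ v, m v ∂P := by
    refine integral_mono_ae
      ((hP.integrable_of_continuous (continuous_of_le_add_mul hk.le hl)).const_mul c)
      (hP.integrable_of_monotoneOn hm) (hP.ae_mem.mono fun v hv => ?_)
    have := hl0 v hv
    have := hlm v hv
    show c * l v ≤ m v
    nlinarith
  rw [h2] at h1
  linarith

/-- The source of all first-order conditions: at the optimal k, any competing mechanism may be
tested through any nonnegative k-Lipschitz minorant of its payments. -/
lemma integral_le_target_of_optimal {P₀ : Measure ℝ} {τ k : ℝ} {q m l : ℝ → ℝ}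
    (hP₀ : IsValuationDist P₀) (hτ : 0 < τ) (hk : 0 < k)
    (hopt : ∀ q' m' k', RSFeasible P₀ τ q' m' k' → k ≤ k') (h : IsMechanism q m)
    (hl : ∀ x y, l x ≤ l y + k * |x - y|) (hl0 : ∀ v ∈ Set.Icc (0 : ℝ) 1, 0 ≤ l v)
    (hlm : ∀ v ∈ Set.Icc (0 : ℝ) 1, l v ≤ m v) : ∫ v, l v ∂P₀ ≤ τ := by
  by_contra! hlt
  obtain ⟨k', hk', hpos, hs⟩ := exists_lt_satisfices hP₀ hτ hk h.monotoneOn_pay hl hl0 hlm hlt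
  exact absurd (hopt q m k' ⟨h, hpos, hs⟩) hk'.not_ge

/-! ### Power distributions and rescaling -/

/-- A power distribution is the law of `t ^ α⁻¹` for `t` uniform on `[0,1]`. -/
lemma IsPowerDist.eq_map {α : ℝ} {P : Measure ℝ} (hα : 0 < α) (h : IsPowerDist α P) :
    P = (volume.restrict (Set.Ioc (0 : ℝ) 1)).map fun t => t ^ α⁻¹ := by
  have := h.1.1
  have hmeas : Measurable fun t : ℝ => t ^ α⁻¹ := measurable_id.pow_const _
  refine Measure.ext_of_Iic _ _ fun x => ?_
  rw [Measure.map_apply hmeas measurableSet_Iic, Measure.restrict_apply (hmeas measurableSet_Iic)]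
  rcases lt_or_ge x 0 with hx | hx
  · have h1 : P (Set.Iic x) = 0 := measure_mono_null (t := (Set.Icc (0 : ℝ) 1)ᶜ)
      (fun y (hy : y ≤ x) (hc : y ∈ Set.Icc (0 : ℝ) 1) => absurd (hc.1.trans hy) hx.not_ge) h.1.2
    have h2 : (fun t : ℝ => t ^ α⁻¹) ⁻¹' Set.Iic x ∩ Set.Ioc 0 1 = ∅ := by
      ext t
      simp only [Set.mem_inter_iff, Set.mem_preimage, Set.mem_Iic, Set.mem_Ioc,
        Set.mem_empty_iff_false, iff_false]
      rintro ⟨h3, h4, -⟩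
      exact absurd ((Real.rpow_pos_of_pos h4 _).le.trans h3) hx.not_ge
    rw [h1, h2, measure_empty]
  rcases le_or_gt x 1 with hx1 | hx1
  · have h2 : (fun t : ℝ => t ^ α⁻¹) ⁻¹' Set.Iic x ∩ Set.Ioc 0 1 = Set.Ioc 0 (x ^ α) := by
      ext t
      simp only [Set.mem_inter_iff, Set.mem_preimage, Set.mem_Iic, Set.mem_Ioc]
      constructor
      · rintro ⟨h3, h4, -⟩
        exact ⟨h4, (Real.rpow_inv_le_iff_of_pos h4.le hx hα).1 h3⟩
      · rintro ⟨h3, h4⟩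
        exact ⟨(Real.rpow_inv_le_iff_of_pos h3.le hx hα).2 h4, h3,
          h4.trans (Real.rpow_le_one hx hx1 hα.le)⟩
    rw [h2, Real.volume_Ioc, sub_zero, ← h.2 x ⟨hx, hx1⟩, ofReal_measureReal]
  · have h1 : P (Set.Iic x) = 1 := by
      refine le_antisymm prob_le_one ?_
      have h3 := h.2 1 (by simp)
      rw [Real.one_rpow] at h3
      have h4 : P (Set.Iic 1) = 1 := by
        rw [← ofReal_measureReal (μ := P), h3, ENNReal.ofReal_one]
      rw [← h4]
      exact measure_mono (Set.Iic_subset_Iic.2 hx1.le)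
    have h2 : (fun t : ℝ => t ^ α⁻¹) ⁻¹' Set.Iic x ∩ Set.Ioc 0 1 = Set.Ioc 0 1 := by
      refine Set.inter_eq_right.2 fun t ht => ?_
      exact (Real.rpow_le_one ht.1.le ht.2 (by positivity)).trans hx1.le
    rw [h1, h2]
    simp

lemma IsPowerDist.integral_eq {α : ℝ} {P : Measure ℝ} (hα : 0 < α) (h : IsPowerDist α P)
    {f : ℝ → ℝ} (hf : Continuous f) : ∫ v, f v ∂P = ∫ t in (0 : ℝ)..1, f (t ^ α⁻¹) := by
  have hmeas : Measurable fun t : ℝ => t ^ α⁻¹ := measurable_id.pow_const _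
  rw [intervalIntegral.integral_of_le zero_le_one]
  conv_lhs => rw [h.eq_map hα]
  rw [integral_map hmeas.aemeasurable hf.aestronglyMeasurable]

/-- Stretching the valuation under a power distribution. -/
lemma IsPowerDist.le_integral_comp_div {α : ℝ} {P : Measure ℝ} (hα : 0 < α) (h : IsPowerDist α P)
    {f : ℝ → ℝ} (hf : Continuous f) {r B : ℝ} (hr : 0 < r) (hr1 : r ≤ 1)
    (hB : ∀ x, 1 ≤ x → B ≤ f x) :
    r ^ α * ∫ v, f v ∂P + (1 - r ^ α) * B ≤ ∫ v, f (v / r) ∂P := by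
  have hpow : Continuous fun t : ℝ => t ^ α⁻¹ := Real.continuous_rpow_const (by positivity)
  have hc : Continuous fun t : ℝ => f (t ^ α⁻¹ / r) := hf.comp (hpow.div_const r)
  have hra : 0 < r ^ α := Real.rpow_pos_of_pos hr _
  have hra1 : r ^ α ≤ 1 := Real.rpow_le_one hr.le hr1 hα.le
  have hinv : (r ^ α) ^ α⁻¹ = r := Real.rpow_rpow_inv hr.le hα.ne'
  rw [h.integral_eq hα hf, h.integral_eq hα (f := fun v => f (v / r)) (hf.comp (continuous_id.div_const r)),
    ← intervalIntegral.integral_add_adjacent_intervals (hc.intervalIntegrable 0 (r ^ α))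
      (hc.intervalIntegrable (r ^ α) 1)]
  -- In the uniform coordinate t, dividing v by r is dividing t by r ^ α. So [0, r ^ α] reproduces
  -- the full integral with weight r ^ α, and beyond it the argument is at least 1.
  refine add_le_add (le_of_eq ?_) ?_
  · have h1 := intervalIntegral.smul_integral_comp_mul_left (a := 0) (b := 1)
      (fun t : ℝ => f (t ^ α⁻¹ / r)) (r ^ α)
    rw [mul_zero, mul_one, smul_eq_mul] at h1
    rw [← h1]
    congr 1
    refine intervalIntegral.integral_congr fun t ht => ?_
    rw [Set.uIcc_of_le zero_le_one] at ht
    rw [Real.mul_rpow hra.le ht.1, hinv, mul_div_cancel_left₀ _ hr.ne']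
  · calc (1 - r ^ α) * B = ∫ _ in r ^ α..1, B := by simp
      _ ≤ _ := by
        refine intervalIntegral.integral_mono_on hra1 (by simp) (hc.intervalIntegrable _ _)
          fun t ht => hB _ ?_
        rw [one_le_div hr, ← hinv]
        exact Real.rpow_le_rpow hra.le ht.1 (by positivity)

lemma nonpos_of_hasDerivAt_of_eventually_nonneg {g : ℝ → ℝ} {d x₀ : ℝ} (hg : HasDerivAt g d x₀)
    (h0 : g x₀ = 0) (h : ∀ᶠ x in 𝓝[<] x₀, 0 ≤ g x) : d ≤ 0 := by
  have h1 : Tendsto (slope g x₀) (𝓝[<] x₀) (𝓝 d) :=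
    (hasDerivAt_iff_tendsto_slope.1 hg).mono_left
      (nhdsWithin_mono _ fun x hx => ne_of_lt hx)
  refine le_of_tendsto h1 ?_
  filter_upwards [h, self_mem_nhdsWithin] with x hx hlt
  rw [slope_def_field, h0, sub_zero]
  exact div_nonpos_of_nonneg_of_nonpos hx (sub_nonpos.2 (le_of_lt hlt))

/-! ### First-order condition for posted prices -/

section PostedPrice

/-- The `k`-Lipschitz envelope of the payments of the posted price `p`. -/
noncomputable def ppEnvelope (p k v : ℝ) : ℝ := min p (k * max (v - p) 0)

variable {p k : ℝ}

lemma ppEnvelope_le_add (hk : 0 ≤ k) (x y : ℝ) :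
    ppEnvelope p k x ≤ ppEnvelope p k y + k * |x - y| := by
  have h0 : 0 ≤ k * |x - y| := by positivity
  have h1 : max (x - p) 0 ≤ max (y - p) 0 + |x - y| := by
    refine max_le ?_ (by positivity)
    have := le_max_left (y - p) 0
    have := le_abs_self (x - y)
    linarith
  have h2 := mul_le_mul_of_nonneg_left h1 hk
  rw [mul_add] at h2
  simp only [ppEnvelope]
  rw [← min_add_add_right]
  exact min_le_min (by linarith) h2

lemma ppEnvelope_nonneg (hp : 0 ≤ p) (hk : 0 ≤ k) (v : ℝ) : 0 ≤ ppEnvelope p k v :=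
  le_min hp (mul_nonneg hk (le_max_right _ _))

lemma ppEnvelope_of_le (hp : 0 ≤ p) {v : ℝ} (hv : v ≤ p) : ppEnvelope p k v = 0 := by
  rw [ppEnvelope, max_eq_right (by linarith), mul_zero, min_eq_right hp]

lemma ppEnvelope_le_ppPay (hp : 0 ≤ p) (v : ℝ) : ppEnvelope p k v ≤ ppPay p v := by
  rcases lt_or_ge v p with hv | hv
  · rw [ppEnvelope_of_le hp hv.le, ppPay_of_lt hv]
  · rw [ppPay_of_le hv]
    exact min_le_left _ _

/-- Payments vanish just below p, so by continuity the envelope is at most 0 at p and rises from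
there at rate at most k. -/
lemma envelope_ppPay_le (hp : p ∈ Set.Ioc (0 : ℝ) 1) (hk : 0 ≤ k) {v : ℝ}
    (hv : v ∈ Set.Icc (0 : ℝ) 1) : envelope (ppPay p) k v ≤ ppEnvelope p k v := by
  have hm := (isMechanism_pp p).monotoneOn_pay
  rcases lt_or_ge v p with hvp | hvp
  · rw [ppEnvelope_of_le hp.1.le hvp.le]
    exact (envelope_le_self hm hk hv).trans (ppPay_of_lt hvp).le
  refine le_min ?_ ?_
  · exact (envelope_le_self hm hk hv).trans (ppPay_of_le hvp).le
  have h1 : envelope (ppPay p) k p ≤ 0 := by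
    refine le_of_tendsto ((continuous_envelope hm hk).continuousAt.continuousWithinAt
      (s := Set.Iio p)) ?_
    filter_upwards [Ioo_mem_nhdsLT hp.1] with y hy
    exact (envelope_le_self hm hk ⟨hy.1.le, hy.2.le.trans hp.2⟩).trans (ppPay_of_lt hy.2).le
  have h2 := envelope_le_add hm hk v p
  rw [abs_of_nonneg (sub_nonneg.2 hvp)] at h2
  rw [max_eq_left (sub_nonneg.2 hvp)]
  linarith

/-- The envelope is jointly homogeneous in price and valuation, so changing the price amounts to
rescaling the valuation. -/
lemma mul_ppEnvelope_div {r : ℝ} (hr : 0 < r) (v : ℝ) :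
    r * ppEnvelope (p / r) k (v / r) = ppEnvelope p k v := by
  rw [ppEnvelope, ppEnvelope, mul_min_of_nonneg _ _ hr.le, mul_left_comm,
    mul_max_of_nonneg _ _ hr.le, mul_sub, mul_zero, mul_div_cancel₀ _ hr.ne',
    mul_div_cancel₀ _ hr.ne']

/-- Under a power distribution an optimal posted price is at least `(1 + α) τ / α`. -/
lemma IsPowerDist.target_le_of_isOptimalPP {α τ : ℝ} {P₀ : Measure ℝ} (hα : 0 < α)
    (h : IsPowerDist α P₀) (hτ : 0 < τ) (hopt : IsOptimalPP P₀ τ p) : (1 + α) * τ ≤ α * p := by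
  obtain ⟨k, ⟨hp, hk, hs⟩, hle⟩ := hopt
  have hP₀ := h.1
  have := hP₀.1
  have hcont : ∀ p, Continuous (ppEnvelope p k) := fun p =>
    continuous_of_le_add_mul hk.le (ppEnvelope_le_add hk.le)
  have hp0 : 0 < p := by
    refine hp.1.lt_of_ne fun h0 => ?_
    have h1 := hs P₀ hP₀
    rw [integral_ppPay, ← h0] at h1
    simp only [wasserstein, sub_self, abs_zero, intervalIntegral.integral_zero] at h1
    linarith
  have hlow : τ ≤ ∫ v, ppEnvelope p k v ∂P₀ := by
    have hm := (isMechanism_pp p).monotoneOn_pay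
    refine (hs.le_integral_envelope hP₀ hm hk.le).trans (integral_mono_ae
      (hP₀.integrable_of_continuous (continuous_envelope hm hk.le))
      (hP₀.integrable_of_continuous (hcont p))
      (hP₀.ae_mem.mono fun v hv => envelope_ppPay_le ⟨hp0, hp.2⟩ hk.le hv))
  have hp1 : p < 1 := by
    refine hp.2.lt_of_ne fun h1 => ?_
    have : ∫ v, ppEnvelope p k v ∂P₀ = ∫ v, (0 : ℝ) ∂P₀ :=
      integral_congr_ae (hP₀.ae_mem.mono fun v hv => ppEnvelope_of_le hp.1 (h1 ▸ hv.2))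
    rw [this, integral_zero] at hlow
    linarith
  have hup : ∀ p' ∈ Set.Icc (0 : ℝ) 1, ∫ v, ppEnvelope p' k v ∂P₀ ≤ τ := by
    intro p' hp'
    by_contra! hlt
    obtain ⟨k', hk', hpos, hs'⟩ := exists_lt_satisfices hP₀ hτ hk
      (isMechanism_pp p').monotoneOn_pay (ppEnvelope_le_add hk.le)
      (fun v _ => ppEnvelope_nonneg hp'.1 hk.le v) (fun v _ => ppEnvelope_le_ppPay hp'.1 v) hlt
    exact absurd (hle p' k' ⟨hp', hpos, hs'⟩) hk'.not_ge
  -- With J(p) the mean of the envelope, homogeneity gives J(p) ≤ r ^ (1 + α) J(p / r) + (1 - r ^ α)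
  -- p. Since J(p) ≥ τ ≥ J(p / r), this function is nonnegative just below its zero r = 1, where its
  -- derivative must be nonpositive.
  have hderiv : HasDerivAt (fun r : ℝ => r ^ (1 + α) * τ + (1 - r ^ α) * p - τ)
      ((1 + α) * τ - α * p) 1 := by
    have h1 := (Real.hasDerivAt_rpow_const (x := 1) (p := 1 + α) (Or.inl one_ne_zero)).mul_const τ
    have h2 := ((Real.hasDerivAt_rpow_const (x := 1) (p := α) (Or.inl one_ne_zero)).const_sub
      1).mul_const p
    exact ((h1.add h2).sub_const τ).congr_deriv (by simp only [Real.one_rpow]; ring)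
  refine sub_nonpos.1 (nonpos_of_hasDerivAt_of_eventually_nonneg hderiv (by simp) ?_)
  -- For r in (p, 1) the competing price p / r stays in [0, 1].
  filter_upwards [Ioo_mem_nhdsLT hp1] with r hr
  have hr0 : 0 < r := hp0.trans hr.1
  -- Applied to the negative, because an upper bound is needed here.
  have h1 := h.le_integral_comp_div hα (f := fun v => -ppEnvelope (p / r) k v)
    (hcont _).neg hr0 hr.2.le (B := -(p / r)) (fun x _ => neg_le_neg (min_le_left _ _))
  have h2 : ∫ v, ppEnvelope p k v ∂P₀ = r * ∫ v, ppEnvelope (p / r) k (v / r) ∂P₀ := by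
    rw [← integral_const_mul]
    simp only [mul_ppEnvelope_div hr0]
  have h3 := hup (p / r) ⟨by positivity, (div_le_one hr0).2 hr.1.le⟩
  rw [integral_neg, integral_neg] at h1
  rw [h2] at hlow
  have hra : 0 < r ^ α := Real.rpow_pos_of_pos hr0 _
  have h4 := mul_le_mul_of_nonneg_left h1 hr0.le
  have h5 := mul_le_mul_of_nonneg_left h3 (mul_pos hr0 hra).le
  have h6 : r * (p / r) = p := mul_div_cancel₀ _ hr0.ne'
  rw [Real.rpow_add hr0, Real.rpow_one]
  have h7 : r * (r ^ α * -∫ v, ppEnvelope (p / r) k v ∂P₀ + (1 - r ^ α) * -(p / r)) =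
      - (r * r ^ α * ∫ v, ppEnvelope (p / r) k v ∂P₀) - (1 - r ^ α) * (r * (p / r)) := by ring
  rw [h7, h6] at h4
  linarith

end PostedPrice

/-! ### First-order condition for mechanisms -/

section Mechanism

variable {q m : ℝ → ℝ} {k : ℝ}

lemma IsMechanism.sub_pay_zero (h : IsMechanism q m) : IsMechanism q fun v => m v - m 0 where
  alloc_mem := h.alloc_mem
  individually_rational v hv := by
    have h0 := h.incentive_compatible v hv 0 (by simp)
    have h1 := (h.alloc_mem 0 (by simp)).1
    nlinarith [mul_nonneg h1 hv.1]
  incentive_compatible v hv w hw := by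
    have := h.incentive_compatible v hv w hw
    linarith

/-- Compressing the valuation scale of a mechanism by the factor `r`. -/
lemma IsMechanism.scale (h : IsMechanism q m) {r : ℝ} (hr : 0 < r) :
    IsMechanism (fun v => q (min (v / r) 1)) fun v => r * m (min (v / r) 1) := by
  have hmem : ∀ v ∈ Set.Icc (0 : ℝ) 1, min (v / r) 1 ∈ Set.Icc (0 : ℝ) 1 := fun v hv =>
    ⟨le_min (div_nonneg hv.1 hr.le) zero_le_one, min_le_right _ _⟩
  have hic : ∀ v ∈ Set.Icc (0 : ℝ) 1, ∀ w ∈ Set.Icc (0 : ℝ) 1,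
      q w * v - r * m w ≤ q (min (v / r) 1) * v - r * m (min (v / r) 1) := by
    intro v hv w hw
    set y := min (v / r) 1 with hy
    have hym := hmem v hv
    rw [← hy] at hym
    have h1 := h.incentive_compatible y hym w hw
    have h2 : y * r ≤ v := by
      rw [← le_div_iff₀ hr]
      exact min_le_left _ _
    have h4 := mul_le_mul_of_nonneg_left h1 hr.le
    -- Either v / r ≤ 1 and the factor vanishes, or the report is capped at 1, where the allocation
    -- is largest.
    have h5 : q w * (v - y * r) ≤ q y * (v - y * r) := by
      rcases le_total (v / r) 1 with hc | hc
      · have : y * r = v := by rw [hy, min_eq_left hc, div_mul_cancel₀ _ hr.ne']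
        simp [this]
      · have : y = 1 := min_eq_right hc
        refine mul_le_mul_of_nonneg_right ?_ (sub_nonneg.2 h2)
        rw [this]
        exact h.monotoneOn_alloc hw (by simp) hw.2
    nlinarith
  refine ⟨fun v hv => h.alloc_mem _ (hmem v hv), fun v hv => ?_, fun v hv w hw =>
    hic v hv _ (hmem w hw)⟩
  have h0 := hic v hv 0 (by simp)
  have h1 := (h.alloc_mem 0 (by simp)).1
  have h2 := h.pay_zero_le
  nlinarith [mul_nonneg h1 hv.1]

/-- An optimal mechanism does not pay the buyer of valuation `0`. -/
lemma pay_zero_eq_zero_of_optimal {P₀ : Measure ℝ} {τ : ℝ} (hP₀ : IsValuationDist P₀) (hτ : 0 < τ)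
    (h : RSFeasible P₀ τ q m k) (hopt : ∀ q' m' k', RSFeasible P₀ τ q' m' k' → k ≤ k') :
    m 0 = 0 := by
  obtain ⟨hmech, hk, hs⟩ := h
  have := hP₀.1
  have hm := hmech.monotoneOn_pay
  have hI := hs.le_integral_envelope hP₀ hm hk.le
  -- Charging everyone the extra amount -m 0 ≥ 0 preserves the mechanism and raises the mean by that
  -- amount.
  have h1 := integral_le_target_of_optimal (l := fun v => envelope m k v - m 0) hP₀ hτ hk hopt
    hmech.sub_pay_zero (fun x y => by linarith [envelope_le_add hm hk.le x y])
    (fun v _ => sub_nonneg.2 (zero_le_envelope hm hk.le v))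
    (fun v hv => sub_le_sub_right (envelope_le_self hm hk.le hv) _)
  rw [integral_sub (hP₀.integrable_of_continuous (continuous_envelope hm hk.le))
    (integrable_const _), integral_const, probReal_univ, one_smul] at h1
  linarith [hmech.pay_zero_le]

/-- Under a power distribution the envelope of an optimal mechanism is at most `(1 + α) τ / α`. -/
lemma IsPowerDist.envelope_one_le {α τ : ℝ} {P₀ : Measure ℝ} (hα : 0 < α)
    (h : IsPowerDist α P₀) (hτ : 0 < τ) (hf : RSFeasible P₀ τ q m k)
    (hopt : ∀ q' m' k', RSFeasible P₀ τ q' m' k' → k ≤ k') :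
    α * envelope m k 1 ≤ (1 + α) * τ := by
  have hP₀ := h.1
  have hm0 := pay_zero_eq_zero_of_optimal hP₀ hτ hf hopt
  obtain ⟨hmech, hk, hs⟩ := hf
  have hm := hmech.monotoneOn_pay
  have hI := hs.le_integral_envelope hP₀ hm hk.le
  have hcont := continuous_envelope hm hk.le
  set L := envelope m k with hL
  -- The scaled minorant r L(min (v / r) 1) has mean at least r (r ^ α τ + (1 - r ^ α) L(1)), which
  -- optimality caps at τ. So this function is nonnegative for r < 1 and vanishes at 1.
  have hderiv : HasDerivAt (fun r : ℝ => τ - (r ^ (1 + α) * τ + (r - r ^ (1 + α)) * L 1))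
      (α * L 1 - (1 + α) * τ) 1 := by
    have h1 := Real.hasDerivAt_rpow_const (x := 1) (p := 1 + α) (Or.inl one_ne_zero)
    have h2 := ((hasDerivAt_id (1 : ℝ)).sub h1).mul_const (L 1)
    exact (((h1.mul_const τ).add h2).const_sub τ).congr_deriv
      (by simp only [Real.one_rpow]; ring)
  refine sub_nonpos.1 (nonpos_of_hasDerivAt_of_eventually_nonneg hderiv (by simp) ?_)
  filter_upwards [Ioo_mem_nhdsLT (zero_lt_one (α := ℝ))] with r hr
  have hmem : ∀ v ∈ Set.Icc (0 : ℝ) 1, min (v / r) 1 ∈ Set.Icc (0 : ℝ) 1 := fun v hv =>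
    ⟨le_min (div_nonneg hv.1 hr.1.le) zero_le_one, min_le_right _ _⟩
  have h1 := integral_le_target_of_optimal (l := fun v => r * L (min (v / r) 1)) hP₀ hτ hk hopt
    (hmech.scale hr.1) (fun x y => ?_)
    (fun v _ => mul_nonneg hr.1.le (hm0 ▸ zero_le_envelope hm hk.le _))
    (fun v hv => mul_le_mul_of_nonneg_left (envelope_le_self hm hk.le (hmem v hv)) hr.1.le)
  · have h2 := h.le_integral_comp_div hα (f := fun v => L (min v 1))
      (hcont.comp (continuous_id.min continuous_const)) hr.1 hr.2.le (B := L 1)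
      (fun x hx => by rw [min_eq_right hx])
    have h3 : ∫ v, L (min v 1) ∂P₀ = ∫ v, L v ∂P₀ :=
      integral_congr_ae (hP₀.ae_mem.mono fun v hv => by simp only [min_eq_left hv.2])
    rw [h3] at h2
    rw [integral_const_mul] at h1
    have hra : 0 < r ^ α := Real.rpow_pos_of_pos hr.1 _
    have h4 := mul_le_mul_of_nonneg_left h2 hr.1.le
    have h5 := mul_le_mul_of_nonneg_left hI (mul_pos hr.1 hra).le
    rw [Real.rpow_add hr.1, Real.rpow_one]
    linarith
  · have h2 := envelope_le_add hm hk.le (min (x / r) 1) (min (y / r) 1)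
    have h3 : r * |min (x / r) 1 - min (y / r) 1| ≤ |x - y| := by
      have h4 : |min (x / r) 1 - min (y / r) 1| ≤ |x / r - y / r| := by
        simpa using abs_min_sub_min_le_max (x / r) 1 (y / r) 1
      rw [← sub_div, abs_div, abs_of_pos hr.1] at h4
      rwa [le_div_iff₀' hr.1] at h4
    have h4 := mul_le_mul_of_nonneg_left h3 hk.le
    have h5 := mul_le_mul_of_nonneg_left h2 hr.1.le
    linarith

end Mechanism

/-! ### Which payment rules are implementable -/

/-- On [d, 1] the maximum is just s; the truncation keeps the integrand continuous on the whole
line. -/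
lemma continuous_div_max_sq {f : ℝ → ℝ} (hf : Continuous f) {d : ℝ} (hd : 0 < d) :
    Continuous fun s => f s / max s d ^ 2 :=
  hf.div₀ ((continuous_id.max continuous_const).pow 2) fun s =>
    pow_ne_zero _ (hd.trans_le (le_max_right s d)).ne'

/-- The average surplus at the top bounds the payments weighted by the inverse square. -/
lemma IsMechanism.integral_div_sq_le_surplus {q m f : ℝ → ℝ} (h : IsMechanism q m)
    (hf : Continuous f) (hfm : ∀ v ∈ Set.Icc (0 : ℝ) 1, f v ≤ m v) {d : ℝ} (hd : 0 < d)
    (hd1 : d ≤ 1) : ∫ s in d..1, f s / max s d ^ 2 ≤ surplus q m 1 := by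
  have hG := continuous_div_max_sq hf hd
  have hmem : ∀ x ∈ Set.Icc d 1, x ∈ Set.Icc (0 : ℝ) 1 := fun x hx => ⟨hd.le.trans hx.1, hx.2⟩
  have hucont : ContinuousOn (surplus q m) (Set.Icc d 1) := by
    have : LipschitzOnWith 1 (surplus q m) (Set.Icc d 1) := by
      refine LipschitzOnWith.of_le_add_mul 1 fun x hx y hy => ?_
      rw [Real.dist_eq, NNReal.coe_one, one_mul]
      rcases le_total y x with hxy | hxy
      · have := h.surplus_sub_le (hmem y hy) (hmem x hx) hxy
        have := le_abs_self (x - y)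
        linarith
      · have := h.surplus_mono (hmem x hx) (hmem y hy) hxy
        have := abs_nonneg (x - y)
        linarith
    exact this.continuousOn
  have hB : ∀ x, HasDerivAt (fun t => -(surplus q m d / d) - ∫ s in d..t, f s / max s d ^ 2)
      (-(f x / max x d ^ 2)) x := fun x =>
    (hG.integral_hasStrictDerivAt d x).hasDerivAt.const_sub _
  -- Formally (u / t)' = (t q - u) / t² = m / t². The subgradient inequality gives this as a
  -- one-sided slope bound, so u need not be differentiable; the term u(d) / d ≥ 0 is dropped at the
  -- end.
  have key := image_le_of_liminf_slope_right_le_deriv_boundary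
    (f := fun t => -(surplus q m t / t)) (a := d) (b := 1)
    (hucont.div continuousOn_id fun x hx => (hd.trans_le hx.1).ne').neg
    (B := fun t => -(surplus q m d / d) - ∫ s in d..t, f s / max s d ^ 2)
    (B' := fun x => -(f x / max x d ^ 2)) (by simp)
    (fun x _ => (hB x).continuousAt.continuousWithinAt) (fun x _ => (hB x).hasDerivWithinAt)
    (fun x hx r hr => ?_) (Set.right_mem_Icc.2 hd1)
  · have := h.surplus_nonneg (hmem d ⟨le_rfl, hd1⟩)
    have : 0 ≤ surplus q m d / d := by positivity
    simp only [div_one] at key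
    linarith
  · have hx0 : 0 < x := hd.trans_le hx.1
    rw [max_eq_left hx.1] at hr
    have hlim : Tendsto (fun z => -(f x / (x * z))) (𝓝[>] x) (𝓝 (-(f x / (x * x)))) := by
      have : ContinuousAt (fun z => -(f x / (x * z))) x :=
        (continuousAt_const.div (continuousAt_const.mul continuousAt_id)
          (mul_pos hx0 hx0).ne').neg
      exact this.tendsto.mono_left nhdsWithin_le_nhds
    rw [pow_two] at hr
    refine Eventually.frequently ?_
    filter_upwards [hlim.eventually (gt_mem_nhds hr), Ioo_mem_nhdsGT hx.2] with z hz hzx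
    refine lt_of_le_of_lt ?_ hz
    have hz0 : 0 < z := hx0.trans hzx.1
    have h1 := h.surplus_ge (hmem z ⟨hx.1.trans hzx.1.le, hzx.2.le⟩) (hmem x ⟨hx.1, hx.2.le⟩)
    have h2 := hfm x (hmem x ⟨hx.1, hx.2.le⟩)
    have h3 : surplus q m x = q x * x - m x := rfl
    have hzx' : 0 < z - x := sub_pos.2 hzx.1
    rw [slope_def_field, div_le_iff₀ hzx']
    have h4 : -(surplus q m z / z) - -(surplus q m x / x) =
        (surplus q m x * z - surplus q m z * x) / (x * z) := by field_simp; ring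
    have h5 : -(f x / (x * z)) * (z - x) = (-(f x) * (z - x)) / (x * z) := by ring
    rw [h4, h5]
    refine div_le_div_of_nonneg_right ?_ (by positivity)
    have h6 := mul_le_mul_of_nonneg_right h1 hx0.le
    have h7 := mul_le_mul_of_nonneg_right h2 hzx'.le
    nlinarith

lemma integral_one_div_sq {a b : ℝ} (ha : 0 < a) (hab : a ≤ b) (c : ℝ) :
    ∫ s in a..b, c / s ^ 2 = c * (1 / a - 1 / b) := by
  have h : ∀ s ∈ Set.uIcc a b, HasDerivAt (fun s : ℝ => -(c * s⁻¹)) (c / s ^ 2) s := by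
    intro s hs
    rw [Set.uIcc_of_le hab] at hs
    have hs0 : s ≠ 0 := (ha.trans_le hs.1).ne'
    exact ((hasDerivAt_inv hs0).const_mul c).neg.congr_deriv (by field_simp)
  rw [intervalIntegral.integral_eq_sub_of_hasDerivAt h]
  · ring
  · refine ContinuousOn.intervalIntegrable fun s hs => ContinuousAt.continuousWithinAt ?_
    rw [Set.uIcc_of_le hab] at hs
    have hs0 : s ≠ 0 := (ha.trans_le hs.1).ne'
    exact continuousAt_const.div (continuousAt_id.pow 2) (pow_ne_zero _ hs0)

lemma integral_id_div_sq {d : ℝ} (hd : 0 < d) (hd1 : d ≤ 1) :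
    ∫ s in d..1, s / max s d ^ 2 = -Real.log d := by
  have h : ∫ s in d..1, s / max s d ^ 2 = ∫ s in d..1, 1 / s := by
    refine intervalIntegral.integral_congr fun s hs => ?_
    rw [Set.uIcc_of_le hd1] at hs
    have hs0 : s ≠ 0 := (hd.trans_le hs.1).ne'
    simp only [max_eq_left hs.1]
    field_simp
  rw [h, integral_one_div_of_pos hd one_pos, one_div, Real.log_inv]

/-- A nondecreasing payment rule that vanishes near `0` is implemented by the allocation rule
`l v / v + ∫ l s / s ^ 2`, provided that this does not exceed `1`. -/
lemma isMechanism_of_pay {l : ℝ → ℝ} (hl : Continuous l) (hmono : MonotoneOn l (Set.Icc 0 1))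
    {d : ℝ} (hd : 0 < d) (hl0 : ∀ v ∈ Set.Icc 0 d, l v = 0)
    (hle : l 1 + ∫ s in d..1, l s / max s d ^ 2 ≤ 1) :
    IsMechanism (fun v => l v / max v d + ∫ s in d..v, l s / max s d ^ 2) l := by
  have hG := continuous_div_max_sq hl hd
  set G : ℝ → ℝ := fun s => l s / max s d ^ 2 with hGdef
  set A : ℝ → ℝ := fun v => ∫ s in d..v, G s with hA
  have hsub : ∀ a b, A b - A a = ∫ s in a..b, G s := fun a b =>
    intervalIntegral.integral_interval_sub_left (hG.intervalIntegrable _ _)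
      (hG.intervalIntegrable _ _)
  have hGeq : ∀ {s}, d ≤ s → G s = l s / s ^ 2 := fun {s} hs => by
    simp only [hGdef, max_eq_left hs]
  have hconst : ∀ (c : ℝ) {a b : ℝ}, 0 < a → a ≤ b →
      IntervalIntegrable (fun s : ℝ => c / s ^ 2) volume a b := by
    intro c a b ha hab
    refine ContinuousOn.intervalIntegrable fun s hs => ContinuousAt.continuousWithinAt ?_
    rw [Set.uIcc_of_le hab] at hs
    have hs0 : s ≠ 0 := (ha.trans_le hs.1).ne'
    exact continuousAt_const.div (continuousAt_id.pow 2) (pow_ne_zero _ hs0)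
  -- Monotonicity of l bounds the integral of l / s² by its end values times the integral of 1 / s².
  have hbounds : ∀ {a b : ℝ}, d ≤ a → a ≤ b → b ≤ 1 →
      l a * (1 / a - 1 / b) ≤ A b - A a ∧ A b - A a ≤ l b * (1 / a - 1 / b) := by
    intro a b ha hab hb
    have ha0 := hd.trans_le ha
    rw [hsub, ← integral_one_div_sq ha0 hab, ← integral_one_div_sq ha0 hab]
    constructor
    · refine intervalIntegral.integral_mono_on hab (hconst _ ha0 hab)
        (hG.intervalIntegrable _ _) fun s hs => ?_
      rw [hGeq (ha.trans hs.1)]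
      exact div_le_div_of_nonneg_right (hmono ⟨ha0.le, hab.trans hb⟩
        ⟨ha0.le.trans hs.1, hs.2.trans hb⟩ hs.1) (by positivity)
    · refine intervalIntegral.integral_mono_on hab (hG.intervalIntegrable _ _)
        (hconst _ ha0 hab) fun s hs => ?_
      rw [hGeq (ha.trans hs.1)]
      exact div_le_div_of_nonneg_right (hmono ⟨ha0.le.trans hs.1, hs.2.trans hb⟩
        ⟨ha0.le.trans hab, hb⟩ hs.2) (by positivity)
  have hAd : A d = 0 := intervalIntegral.integral_same
  have hAzero : ∀ v ∈ Set.Icc 0 d, A v = 0 := by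
    intro v hv
    have : A v = ∫ _ in d..v, (0 : ℝ) := by
      refine intervalIntegral.integral_congr fun s hs => ?_
      rw [Set.uIcc_of_ge hv.2] at hs
      simp only [hGdef, hl0 s ⟨hv.1.trans hs.1, hs.2⟩, zero_div]
    rw [this, intervalIntegral.integral_zero]
  have hlnn : ∀ v ∈ Set.Icc (0 : ℝ) 1, 0 ≤ l v := fun v hv => by
    rw [← hl0 0 ⟨le_rfl, hd.le⟩]
    exact hmono (by simp) hv hv.1
  have hAnn : ∀ v ∈ Set.Icc (0 : ℝ) 1, 0 ≤ A v := by
    intro v hv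
    rcases le_total v d with hvd | hvd
    · rw [hAzero v ⟨hv.1, hvd⟩]
    · have h1 := (hbounds le_rfl hvd hv.2).1
      rw [hl0 d ⟨hd.le, le_rfl⟩, hAd] at h1
      linarith
  -- The truthful surplus is thus v A(v).
  have hdiag : ∀ v ∈ Set.Icc (0 : ℝ) 1, (l v / max v d + A v) * v - l v = A v * v := by
    intro v hv
    rcases le_total v d with hvd | hvd
    · rw [hl0 v ⟨hv.1, hvd⟩]
      ring
    · rw [max_eq_left hvd]
      have : v ≠ 0 := (hd.trans_le hvd).ne'
      field_simp
      ring
  refine ⟨fun v hv => ⟨add_nonneg (div_nonneg (hlnn v hv) (hd.le.trans (le_max_right _ _)))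
    (hAnn v hv), ?_⟩, fun v hv => ?_, fun v hv w hw => ?_⟩
  -- By the lower bound on A(1) - A(v), the allocation at v ≥ d is at most l(1) + A(1), so only the
  -- constraint at the top matters.
  · show l v / max v d + A v ≤ 1
    rcases le_total v d with hvd | hvd
    · rw [hAzero v ⟨hv.1, hvd⟩, hl0 v ⟨hv.1, hvd⟩]
      norm_num
    · have h1 := (hbounds hvd hv.2 le_rfl).1
      have h2 := hmono hv (by simp) hv.2
      rw [max_eq_left hvd]
      have h3 : l 1 + A 1 ≤ 1 := hle
      have h4 : l v * (1 / v - 1 / 1) = l v / v - l v := by ring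
      linarith
  · show 0 ≤ (l v / max v d + A v) * v - l v
    rw [hdiag v hv]
    exact mul_nonneg (hAnn v hv) hv.1
  · show (l w / max w d + A w) * v - l w ≤ (l v / max v d + A v) * v - l v
    rw [hdiag v hv]
    rcases le_total w d with hwd | hwd
    · rw [hl0 w ⟨hw.1, hwd⟩, hAzero w ⟨hw.1, hwd⟩]
      have := mul_nonneg (hAnn v hv) hv.1
      simpa using this
    rw [max_eq_left hwd]
    have hw0 : 0 < w := hd.trans_le hwd
    rcases le_total v d with hvd | hvd
    · rw [hAzero v ⟨hv.1, hvd⟩]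
      have h1 := (hbounds le_rfl hwd hw.2).2
      rw [hAd, sub_zero] at h1
      have h2 : l w / w + A w ≤ l w / d := by
        have : l w * (1 / d - 1 / w) = l w / d - l w / w := by ring
        linarith
      have h3 := mul_le_mul_of_nonneg_right h2 hv.1
      have h4 : l w / d * v ≤ l w := by
        rw [div_mul_eq_mul_div, div_le_iff₀ hd]
        exact mul_le_mul_of_nonneg_left hvd (hlnn w hw)
      linarith
    · have hv0 : 0 < v := hd.trans_le hvd
      -- Multiplied by v, this is incentive compatibility. For w ≤ v it is the lower bound on the
      -- increment of A, and for v ≤ w the upper bound.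
      have h1 : l w * (1 / w - 1 / v) ≤ A v - A w := by
        rcases le_total w v with hwv | hwv
        · exact (hbounds hwd hwv hv.2).1
        · have := (hbounds hvd hwv hw.2).2
          have h2 : l w * (1 / w - 1 / v) = -(l w * (1 / v - 1 / w)) := by ring
          linarith
      have h2 := mul_le_mul_of_nonneg_right h1 hv0.le
      have h3 : l w * (1 / w - 1 / v) * v = l w / w * v - l w := by
        field_simp
      linarith

/-! ### The allocation constraint binds at the top -/

section Slack

variable {q m : ℝ → ℝ} {k τ α : ℝ} {P₀ : Measure ℝ}

lemma envelope_le_mul (hm : MonotoneOn m (Set.Icc 0 1)) (hm0 : m 0 = 0) (hk : 0 ≤ k) {v : ℝ}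
    (hv : 0 ≤ v) : envelope m k v ≤ k * v := by
  have := envelope_le hm hk v (w := 0) (by simp)
  rwa [hm0, zero_add, sub_zero, abs_of_nonneg hv] at this

/-- Payments cannot increase at the full rate everywhere. -/
lemma IsMechanism.exists_envelope_lt (h : IsMechanism q m) (hm0 : m 0 = 0) (hk : 0 < k) :
    ∃ d ∈ Set.Ioo (0 : ℝ) 1, envelope m k d < k * d := by
  by_contra! hc
  have hm := h.monotoneOn_pay
  -- With this d the integral of k / s over [d, 1] is 2, more than any surplus at 1 under
  -- nonnegative payments.
  set d := Real.exp (-(2 / k)) with hd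
  have hd0 : 0 < d := Real.exp_pos _
  have hd1 : d < 1 := by
    rw [hd, Real.exp_lt_one_iff]
    have : 0 < 2 / k := by positivity
    linarith
  have hcont := continuous_envelope hm hk.le
  have h1 := h.integral_div_sq_le_surplus hcont (fun v hv => envelope_le_self hm hk.le hv) hd0 hd1.le
  have h2 : k * -Real.log d ≤ ∫ s in d..1, envelope m k s / max s d ^ 2 := by
    rw [← integral_id_div_sq hd0 hd1.le, ← intervalIntegral.integral_const_mul]
    refine intervalIntegral.integral_mono_on_of_le_Ioo hd1.le
      ((continuous_div_max_sq continuous_id hd0).const_mul k |>.intervalIntegrable _ _)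
      ((continuous_div_max_sq hcont hd0).intervalIntegrable _ _) fun s hs => ?_
    rw [← mul_div_assoc]
    exact div_le_div_of_nonneg_right (hc s ⟨hd0.trans hs.1, hs.2⟩) (by positivity)
  rw [hd, Real.log_exp, neg_neg, mul_div_cancel₀ _ hk.ne'] at h2
  have h3 := (h.alloc_mem 1 (by simp)).2
  have h4 := hm (show (0 : ℝ) ∈ Set.Icc (0 : ℝ) 1 by simp) (show (1 : ℝ) ∈ _ by simp) zero_le_one
  simp only [surplus] at h1
  linarith

/-- A gap below the line k v at one point d persists on (d, 1], since the envelope cannot rise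
faster than k; that interval has positive mass. -/
lemma IsPowerDist.integral_envelope_lt (hα : 0 < α) (h : IsPowerDist α P₀)
    (hmech : IsMechanism q m) (hm0 : m 0 = 0) (hk : 0 < k) :
    ∫ v, envelope m k v ∂P₀ < ∫ v, k * v ∂P₀ := by
  have hP₀ := h.1
  have := hP₀.1
  have hm := hmech.monotoneOn_pay
  obtain ⟨d, hd, hlt⟩ := hmech.exists_envelope_lt hm0 hk
  have hcont := continuous_envelope hm hk.le
  have i1 : Integrable (fun v => k * v) P₀ :=
    hP₀.integrable_of_continuous (continuous_const_mul k)
  have i2 := hP₀.integrable_of_continuous hcont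
  have hmass : 0 < P₀.real (Set.Ioi d) := by
    rw [← Set.compl_Iic, probReal_compl_eq_one_sub measurableSet_Iic, h.2 d ⟨hd.1.le, hd.2.le⟩]
    exact sub_pos.2 (Real.rpow_lt_one hd.1.le hd.2 hα)
  have h1 : P₀.real (Set.Ioi d) * (k * d - envelope m k d) ≤
      ∫ v, (k * v - envelope m k v) ∂P₀ := by
    rw [← smul_eq_mul, ← integral_indicator_const _ measurableSet_Ioi]
    refine integral_mono_ae ((integrable_const _).indicator measurableSet_Ioi) (i1.sub i2)
      (hP₀.ae_mem.mono fun v hv => ?_)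
    show (Set.Ioi d).indicator _ v ≤ k * v - envelope m k v
    by_cases hvd : v ∈ Set.Ioi d
    · rw [Set.indicator_of_mem hvd]
      have h2 := envelope_le_add hm hk.le v d
      rw [abs_of_pos (sub_pos.2 hvd)] at h2
      linarith
    · rw [Set.indicator_of_notMem hvd]
      exact sub_nonneg.2 (envelope_le_mul hm hm0 hk.le hv.1)
  rw [integral_sub i1 i2] at h1
  have := mul_pos hmass (sub_pos.2 hlt)
  linarith

/-- Since ε log ε tends to 0, a small perturbation meets both demands: its offset costs less than
the gain γ, and its allocation cost fits into the slack η. -/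
lemma exists_small (k : ℝ) {γ η : ℝ} (hγ : 0 < γ) (hη : 0 < η) :
    ∃ ε ∈ Set.Ioo (0 : ℝ) 1, k * ε < γ ∧ ε * k * (1 - Real.log (ε ^ 2)) ≤ η := by
  have h1 : Tendsto (fun ε : ℝ => k * ε) (𝓝[>] 0) (𝓝 (k * 0)) :=
    (continuous_const_mul k).continuousAt.tendsto.mono_left nhdsWithin_le_nhds
  have h2 : Tendsto (fun ε : ℝ => k * ε - 2 * k * (Real.log ε * ε)) (𝓝[>] 0)
      (𝓝 (k * 0 - 2 * k * 0)) :=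
    h1.sub ((by simpa using tendsto_log_mul_rpow_nhdsGT_zero one_pos :
      Tendsto (fun ε : ℝ => Real.log ε * ε) (𝓝[>] 0) (𝓝 0)).const_mul _)
  rw [mul_zero] at h1
  rw [mul_zero, mul_zero, sub_zero] at h2
  obtain ⟨ε, hε1, hε2, hε⟩ := ((h1.eventually (gt_mem_nhds hγ)).and
    ((h2.eventually (gt_mem_nhds hη)).and (Ioo_mem_nhdsGT one_pos))).exists
  refine ⟨ε, hε, hε1, ?_⟩
  rw [Real.log_pow]
  push_cast
  linarith

/-- The allocation of an optimal mechanism is exhausted by its envelope at the top. -/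
lemma IsPowerDist.one_le_surplus_add_envelope (hα : 0 < α) (h : IsPowerDist α P₀) (hτ : 0 < τ)
    (hf : RSFeasible P₀ τ q m k) (hopt : ∀ q' m' k', RSFeasible P₀ τ q' m' k' → k ≤ k') :
    1 ≤ surplus q m 1 + envelope m k 1 := by
  by_contra! hlt
  have hP₀ := h.1
  have := hP₀.1
  have hm0 := pay_zero_eq_zero_of_optimal hP₀ hτ hf hopt
  obtain ⟨hmech, hk, hs⟩ := hf
  have hm := hmech.monotoneOn_pay
  have hI := hs.le_integral_envelope hP₀ hm hk.le
  have hgap := h.integral_envelope_lt hα hmech hm0 hk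
  have hcont := continuous_envelope hm hk.le
  have hLlip := envelope_le_add hm hk.le
  have hLmono := monotoneOn_envelope hm hk.le
  have hLself : ∀ v ∈ Set.Icc (0 : ℝ) 1, envelope m k v ≤ m v := fun v hv =>
    envelope_le_self hm hk.le hv
  have hLmul : ∀ v, 0 ≤ v → envelope m k v ≤ k * v := fun v hv => envelope_le_mul hm hm0 hk.le hv
  have hL0 : ∀ v, 0 ≤ envelope m k v := fun v => hm0 ▸ zero_le_envelope hm hk.le v
  set L := envelope m k
  obtain ⟨ε, hε, hε1, hε2⟩ := exists_small k (sub_pos.2 hgap) (sub_pos.2 hlt)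
  set d := ε ^ 2 with hd
  have hε0 := hε.1
  have hε' : 0 < 1 - ε := sub_pos.2 hε.2
  have hd0 : 0 < d := by positivity
  have hd1 : d ≤ 1 := pow_le_one₀ hε0.le hε.2.le
  -- The offset k d, with d = ε², makes the positive part vanish on [0, d], as implementability
  -- requires. It costs only order ε² in mean, against a gain of order ε, while the allocation cost
  -- ε k (1 - log d) still tends to 0.
  set l₀ : ℝ → ℝ := fun v => (1 - ε) * L v + ε * (k * v) - k * d with hl₀
  set l : ℝ → ℝ := fun v => max (l₀ v) 0 with hl
  have hlip : ∀ x y, l x ≤ l y + k * |x - y| := by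
    intro x y
    have h0 : 0 ≤ k * |x - y| := by positivity
    have h1 := mul_le_mul_of_nonneg_left (hLlip x y) hε'.le
    have h2 := mul_le_mul_of_nonneg_left (le_abs_self (x - y)) (mul_pos hε0 hk).le
    refine max_le ?_ (by have := le_max_right (l₀ y) 0; simp only [hl]; linarith)
    have := le_max_left (l₀ y) 0
    simp only [hl, hl₀] at this ⊢
    linarith
  have hlc := continuous_of_le_add_mul hk.le hlip
  have hlmono : MonotoneOn l (Set.Icc 0 1) := by
    intro x hx y hy hxy
    have h1 := mul_le_mul_of_nonneg_left (hLmono hx hy hxy) hε'.le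
    have h2 := mul_le_mul_of_nonneg_left hxy (mul_pos hε0 hk).le
    refine max_le_max_right _ ?_
    simp only [hl₀]
    linarith
  have hlzero : ∀ v ∈ Set.Icc 0 d, l v = 0 := by
    intro v hv
    refine max_eq_right ?_
    have h1 := mul_le_mul_of_nonneg_left (hLmul v hv.1) hε'.le
    have h2 := mul_le_mul_of_nonneg_left hv.2 hk.le
    simp only [hl₀]
    linarith
  have hlle : ∀ v, 0 ≤ v → l v ≤ (1 - ε) * L v + ε * (k * v) := by
    intro v hv
    have h1 := mul_nonneg hε'.le (hL0 v)
    have h2 : 0 ≤ ε * (k * v) := by positivity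
    have h3 : 0 ≤ k * d := by positivity
    exact max_le (by simp only [hl₀]; linarith) (by linarith)
  have i1 := ((continuous_div_max_sq hcont hd0).const_mul (1 - ε)).intervalIntegrable
    (μ := volume) d 1
  have i2 := ((continuous_div_max_sq continuous_id hd0).const_mul (ε * k)).intervalIntegrable
    (μ := volume) d 1
  -- The mixture needs at most (1 - ε)(L(1) + u(1)) + ε k (1 - log d), and the last term is at most
  -- 1 - u(1) - L(1) by the choice of ε.
  have halloc : l 1 + ∫ s in d..1, l s / max s d ^ 2 ≤ 1 := by
    have h1 : ∫ s in d..1, l s / max s d ^ 2 ≤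
        ∫ s in d..1, ((1 - ε) * (L s / max s d ^ 2) + ε * k * (s / max s d ^ 2)) := by
      refine intervalIntegral.integral_mono_on hd1
        ((continuous_div_max_sq hlc hd0).intervalIntegrable _ _) (i1.add i2) fun s hs => ?_
      have h2 : (1 - ε) * (L s / max s d ^ 2) + ε * k * (s / max s d ^ 2) =
          ((1 - ε) * L s + ε * (k * s)) / max s d ^ 2 := by ring
      rw [h2]
      exact div_le_div_of_nonneg_right (hlle s (hd0.le.trans hs.1)) (by positivity)
    have h2 := intervalIntegral.integral_add i1 i2
    simp only [id] at h2
    rw [h2, intervalIntegral.integral_const_mul, intervalIntegral.integral_const_mul,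
      integral_id_div_sq hd0 hd1] at h1
    have h3 := mul_le_mul_of_nonneg_left
      (hmech.integral_div_sq_le_surplus hcont hLself hd0 hd1) hε'.le
    have h4 := hlle 1 zero_le_one
    have h5 := hmech.surplus_nonneg (v := 1) (by simp)
    have h6 := mul_nonneg hε0.le (add_nonneg h5 (hL0 1))
    linarith
  have hfin := integral_le_target_of_optimal hP₀ hτ hk hopt
    (isMechanism_of_pay hlc hlmono hd0 hlzero halloc) hlip (fun v _ => le_max_right _ _)
    (fun v _ => le_rfl)
  have j1 := hP₀.integrable_of_continuous (hcont.const_mul (1 - ε))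
  have j2 := hP₀.integrable_of_continuous ((continuous_id.const_mul k).const_mul ε)
  have hlow : ∫ v, l₀ v ∂P₀ ≤ ∫ v, l v ∂P₀ :=
    integral_mono ((j1.add j2).sub (integrable_const _)) (hP₀.integrable_of_continuous hlc)
      fun v => le_max_left _ _
  have hval : ∫ v, l₀ v ∂P₀ = (1 - ε) * ∫ v, L v ∂P₀ + ε * ∫ v, k * v ∂P₀ - k * d := by
    have h1 := integral_sub (j1.add j2) (integrable_const (k * d))
    have h2 := integral_add j1 j2
    simp only [Pi.add_apply, id, integral_const_mul ε, integral_const_mul (1 - ε),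
      integral_const, probReal_univ, one_smul] at h1 h2
    rw [← h2, ← h1]
  rw [hval] at hlow
  -- The gain in mean, ε (∫ k v - ∫ L), exceeds the offset k ε², so the mean of l is above τ, which
  -- optimality forbids.
  have h9 := mul_lt_mul_of_pos_left hε1 hε0
  have h10 : k * d = ε * (k * ε) := by rw [hd]; ring
  linarith

end Slack

/-! ### Conclusion -/

/-- Under a power distribution every buyer prefers the optimal mechanism to the optimal posted
price. -/
lemma IsPowerDist.surplus_pp_le {α τ p : ℝ} {P₀ : Measure ℝ} {q m : ℝ → ℝ} (hα : 0 < α)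
    (h : IsPowerDist α P₀) (hτ : 0 < τ) (hRS : IsOptimalRS P₀ τ q m) (hPP : IsOptimalPP P₀ τ p)
    {v : ℝ} (hv : v ∈ Set.Icc (0 : ℝ) 1) :
    surplus (ppAlloc p) (ppPay p) v ≤ surplus q m v := by
  obtain ⟨k, hf, hopt⟩ := hRS
  have h1 := h.target_le_of_isOptimalPP hα hτ hPP
  have h2 := h.envelope_one_le hα hτ hf hopt
  have h3 := h.one_le_surplus_add_envelope hα hτ hf hopt
  have h4 := hf.1.surplus_sub_le hv (by simp) hv.2
  -- Together with `h3` this gives surplus at least 1 - p at the top, and `h4` carries it down to v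
  -- at slope at most 1.
  have h5 : envelope m k 1 ≤ p := le_of_mul_le_mul_left (h2.trans h1) hα
  rw [surplus_pp]
  exact max_le (by linarith) (hf.1.surplus_nonneg hv)

end RobustPricing

theorem theorem3 :
    (∀ (P₀ : Measure ℝ) (τ : ℝ), RobustPricing.IsRegular P₀ → 0 < τ →
      (τ < maxRevenue P₀ →
        (∃ q m : ℝ → ℝ, IsOptimalRS P₀ τ q m) ∧ ∃ p : ℝ, IsOptimalPP P₀ τ p) ∧
      ∀ (q m : ℝ → ℝ) (p : ℝ), IsOptimalRS P₀ τ q m → IsOptimalPP P₀ τ p →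
        ∃ vRS ∈ Set.Icc p 1, ∀ v ∈ Set.Icc (0 : ℝ) 1,
          (surplus (ppAlloc p) (ppPay p) v ≤ surplus q m v ↔ v ≤ vRS)) ∧
    (∀ (α : ℝ) (P₀ : Measure ℝ) (τ : ℝ), 1 ≤ α → IsPowerDist α P₀ → 0 < τ →
      (τ < maxRevenue P₀ →
        (∃ q m : ℝ → ℝ, IsOptimalRS P₀ τ q m) ∧ ∃ p : ℝ, IsOptimalPP P₀ τ p) ∧
      ∀ (q m : ℝ → ℝ) (p : ℝ), IsOptimalRS P₀ τ q m → IsOptimalPP P₀ τ p →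
        ∀ v ∈ Set.Icc (0 : ℝ) 1,
          surplus (ppAlloc p) (ppPay p) v ≤ surplus q m v) := by
  refine ⟨fun P₀ τ hP₀ hτ => ⟨exists_isOptimal hP₀.1 hτ, fun q m p hRS hPP => ?_⟩,
    fun α P₀ τ hα hP₀ hτ => ⟨exists_isOptimal hP₀.1 hτ, fun q m p hRS hPP v hv =>
      hP₀.surplus_pp_le (by linarith) hτ hRS hPP hv⟩⟩
  obtain ⟨k, hf, -⟩ := hRS
  obtain ⟨k', hf', -⟩ := hPP
  exact exists_surplus_threshold hf.1 hf'.1
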